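/- Let $d\ge 1$ and let $H\in C^1(\mathbb{R}^d)$ be strictly convex, coercive in the sense that $H(p)/|p|\to+\infty$ as $|p|\to\infty$, and uniformly directionally convex: for every $R>0$, $$\lambda_R:=\inf_{p\ne q\in \overline B(0,R)}\left\langle \frac{DH(p)-DH(q)}{|DH(p)-DH(q)|},\frac{p-q}{|p-q|}\right\rangle>0 .$$ (For $R=0$ the infimum over the empty set is $\lambda_0=+\infty$, and $1/\infty=0$.) Let $L(q)=\max_{p}\{\langle p,q\rangle-H(p)\}$ be the Legendre transform of $H$, let $u_0:\mathbb{R}^d\to\mathbb{R}$ be Lipschitz with Lipschitz constant $M\ge 0$, let $t>0$, and let $$u(t,x)=\min_{y\in\mathbb{R}^d}\Big\{u_0(y)+t\,L\Big(\frac{x-y}{t}\Big)\Big\}$$ be the Hopf--Lax solution of $u_t+H(D_xu)=0$, $u(0,\cdot)=u_0$. Then: (1) For almost every $x$, $u(t,\cdot)$ is differentiable at $x$ and the set of slopes of backward optimal rays $$\Big\{\tfrac{x-y}{t}: u(t,x)=u_0(y)+t\,L\big(\tfrac{x-y}{t}\big)\Big\}$$ is the singleton $\{\mathbf b(t,x)\}$,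 where $\mathbf b(t,x)=DH(D_xu(t,x))$. (2) $\mathbf b(t,\cdot)\in BV_{\mathrm{loc}}(\mathbb{R}^d,\mathbb{R}^d)$, that is, on every bounded open set it is integrable and its distributional partial derivatives are finite signed measures. (3) Suppose moreover that $H$ is normalized by $H(0)=0$ and $DH(0)=0$. Put $$\Lambda_M=\max\{|q|:L(q)\le M|q|\},\qquad \gamma_M=\lambda_{R_M}\quad\text{with}\quad R_M=\max_{|q|\le\Lambda_M}|DL(q)| .$$ Then for every bounded open set $\Omega\subset\mathbb{R}^d$ of finite perimeter, $$|D\mathbf b(t,\cdot)|(\Omega)\le\frac1{\gamma_M}\Big(\Lambda_M+\frac{\operatorname{diam}(\Omega)}{t}\Big)\mathcal H^{d-1}(\partial\Omega)+\frac{\sqrt d}{t}\,|\Omega| ,$$ where $\mathcal H^{d-1}$ is the $(d-1)$-dimensional Hausdorff measure (normalized to agree with surface area), $|\Omega|$ is the Lebesgue measure, and $$|D\mathbf b(t,\cdot)|(\Omega)=\sup\Big\{\sum_{i=1}^d\int_\Omega \mathbf b_i(t,x)\operatorname{div}\varphi_i(x)\,dx:\ \varphi_1,\dots,\varphi_d\in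 C^1_c(\Omega,\mathbb{R}^d),\ \sum_i|\varphi_i(x)|^2\le1\text{ for all }x\Big\}.$$ -/

import Mathlib

open MeasureTheory Filter Topology Set
open scoped ENNReal NNReal

noncomputable section

namespace HamiltonJacobi

/-- Euclidean space `ℝ^d` with its Euclidean norm. -/
abbrev E (d : ℕ) : Type := EuclideanSpace ℝ (Fin d)

/-! ### The Hamiltonian -/

/-- Coercivity (superlinear growth): `H(p)/|p| → +∞` as `|p| → ∞`. -/
def Coercive {d : ℕ} (H : E d → ℝ) : Prop :=
  Tendsto (fun p : E d => H p / ‖p‖) (Bornology.cobounded (E d)) atTop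

/-- The constant `λ_R`: the infimum over `p ≠ q` in the closed ball of radius `R` about `0` of
`⟨(DH(p) - DH(q)) / |DH(p) - DH(q)|, (p - q) / |p - q|⟩`. It takes values in `[0, ∞]`, so that the
infimum over the empty set (the case `R = 0`) is `+∞`; a negative number is read as `0`. -/
def dirConvexityConst {d : ℕ} (H : E d → ℝ) (R : ℝ) : ℝ≥0∞ :=
  ⨅ (p ∈ Metric.closedBall (0 : E d) R) (q ∈ Metric.closedBall (0 : E d) R) (_ : p ≠ q),
    ENNReal.ofReal (inner ℝ
      (‖gradient H p - gradient H q‖⁻¹ • (gradient H p - gradient H q))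
      (‖p - q‖⁻¹ • (p - q)))

/-- Uniform directional convexity: `λ_R > 0` for every `R > 0`. -/
def UniformlyDirectionallyConvex {d : ℕ} (H : E d → ℝ) : Prop :=
  ∀ R : ℝ, 0 < R → 0 < dirConvexityConst H R

/-- The Legendre transform `L(q) = max_p {⟨p, q⟩ - H(p)}`. -/
def legendre {d : ℕ} (H : E d → ℝ) (q : E d) : ℝ :=
  ⨆ p : E d, (inner ℝ p q - H p)

/-- `Λ_M = max {|q| : L(q) ≤ M |q|}`. -/
def speedBound {d : ℕ} (H : E d → ℝ) (M : ℝ) : ℝ :=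
  sSup {r : ℝ | ∃ q : E d, legendre H q ≤ M * ‖q‖ ∧ r = ‖q‖}

/-- `max {|DL(q)| : |q| ≤ Λ_M}`. -/
def momentumBound {d : ℕ} (H : E d → ℝ) (M : ℝ) : ℝ :=
  sSup {r : ℝ | ∃ q : E d, ‖q‖ ≤ speedBound H M ∧ r = ‖gradient (legendre H) q‖}

/-- `γ_M = λ_R` with `R = max {|DL(q)| : |q| ≤ Λ_M}`. -/
def gammaConst {d : ℕ} (H : E d → ℝ) (M : ℝ) : ℝ≥0∞ :=
  dirConvexityConst H (momentumBound H M)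

/-! ### The Hopf-Lax solution and its backward characteristics -/

/-- `u(t,x) = min_y {u₀(y) + t L((x - y)/t)}` (used for `t > 0`). -/
def hopfLax {d : ℕ} (H : E d → ℝ) (u₀ : E d → ℝ) (t : ℝ) (x : E d) : ℝ :=
  ⨅ y : E d, (u₀ y + t * legendre H (t⁻¹ • (x - y)))

/-- The set of slopes `(x - y)/t` of the backward optimal rays through `(t,x)`. -/
def backwardSlopes {d : ℕ} (H : E d → ℝ) (u₀ : E d → ℝ) (t : ℝ) (x : E d) : Set (E d) :=
  {v | ∃ y : E d, v = t⁻¹ • (x - y) ∧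
    hopfLax H u₀ t x = u₀ y + t * legendre H (t⁻¹ • (x - y))}

/-- `b(t,x) = DH(D_x u(t,x))`, meaningful where `u(t,·)` is differentiable. -/
def slope {d : ℕ} (H : E d → ℝ) (u₀ : E d → ℝ) (t : ℝ) (x : E d) : E d :=
  gradient H (gradient (hopfLax H u₀ t) x)

/-! ### Functions of bounded variation -/

/-- The divergence of a vector field. -/
def divergence {d : ℕ} (φ : E d → E d) (x : E d) : ℝ :=
  ∑ j : Fin d, (fderiv ℝ φ x (EuclideanSpace.single j 1)) j

/-- `|Df|(Ω)`: the supremum of `∑_i ∫_Ω f_i div φ_i` over `φ ∈ [C¹_c(Ω, ℝ^d)]^m` with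
`‖φ‖_∞ ≤ 1` (the pointwise norm of the `m × d` matrix `φ` being the Euclidean one). -/
def totalVariation {d m : ℕ} (f : E d → E m) (Ω : Set (E d)) : ℝ≥0∞ :=
  ⨆ (φ : Fin m → E d → E d)
    (_ : ∀ i, ContDiff ℝ 1 (φ i) ∧ HasCompactSupport (φ i) ∧ tsupport (φ i) ⊆ Ω)
    (_ : ∀ x, ∑ i, ‖φ i x‖ ^ 2 ≤ 1),
    ENNReal.ofReal (∑ i, ∫ x in Ω, f x i * divergence (φ i) x)

/-- `f ∈ BV(Ω, ℝ^m)`: `f` is integrable on `Ω` and the distributional partial derivatives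
`D_j f_i` on `Ω` are finite signed measures. -/
def IsBVOn {d m : ℕ} (f : E d → E m) (Ω : Set (E d)) : Prop :=
  IntegrableOn f Ω ∧
    ∃ D : Fin m → Fin d → SignedMeasure (E d),
      ∀ (i : Fin m) (j : Fin d) (φ : E d → ℝ),
        ContDiff ℝ 1 φ → HasCompactSupport φ → tsupport φ ⊆ Ω →
          ∫ x in Ω, f x i * fderiv ℝ φ x (EuclideanSpace.single j 1) = - ∫ᵛ x, φ x ∂<•(D i j)

/-- `f ∈ BV_loc(ℝ^d, ℝ^m)`: `f` is of bounded variation on every bounded open set. -/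
def IsLocallyBV {d m : ℕ} (f : E d → E m) : Prop :=
  ∀ Ω : Set (E d), IsOpen Ω → Bornology.IsBounded Ω → IsBVOn f Ω

/-- The perimeter of `Ω`: the total variation on `ℝ^d` of the indicator function of `Ω`. -/
def perimeter {d : ℕ} (Ω : Set (E d)) : ℝ≥0∞ :=
  ⨆ (φ : E d → E d) (_ : ContDiff ℝ 1 φ ∧ HasCompactSupport φ) (_ : ∀ x, ‖φ x‖ ≤ 1),
    ENNReal.ofReal (∫ x in Ω, divergence φ x)

end HamiltonJacobi

end

/-! Reduction to feet. Directional convexity makes `DH` strictly monotone, and coercivity makes it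
proper and onto, so `DH` is a homeomorphism with inverse `DL`. The Hopf-Lax function is
`M`-Lipschitz, hence differentiable almost everywhere. At such an `x`, comparing it with the cost of
a minimizer `y` gives `Du = DL((x - y)/t)`, so the minimizer is unique and equals the foot `F(x) = x
- t b(x)`. Everything about `b` thus follows from `F`, since `b = (x - F)/t`.

Monotonicity of feet. Let `R > M` and let `C` be a linear map with `⟨C(p - q), DH(p) - DH(q)⟩ ≥ 0`
on the ball of radius `R`. Then `tr(Cᵀ DF) ≥ 0` as a distribution. To see this, replace `F` by the
mean of `y` under the weight `exp(-n · cost)`. Its derivative is `-n` times a covariance of `y` with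
`DL((x - y)/t)`, and since `(x - y)/t = DH(DL((x - y)/t))`, the vectors `C DL((x - y)/t)` and `y`
are oppositely ordered. A Chebyshev inequality gives the sign (`pairing_fderiv_gibbsMean_nonneg`),
and Laplace's method lets `n → ∞` (`exists_integral_pairing_foot_nonpos`).

Control by the divergence. With `γ = λ_R` and `‖B‖ ≤ 1`, the map `C = I - γB` is admissible, so `γ
tr(Bᵀ DF) ≤ div F` (`eventually_mul_pairing_fderiv_mollify_le`, stated for mollifications). Hence
`div F` is a nonnegative distribution dominating every partial derivative of `F`. Nonnegative
distributions are measures, which gives local bounded variation.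

The quantitative bound. Integrating over `Ω`, the variation of `F` is at most `γ⁻¹ ∫_Ω div F`. A
divergence inequality on open sets with `H^{d-1}(∂Ω) < ∞` (`setIntegral_divergence_le`) bounds this
by `γ⁻¹ sup |F - c| · H^{d-1}(∂Ω)` with `c ∈ Ω`, where `|F - c| ≤ tΛ_M + diam Ω`. The identity part
of `x - F` contributes `√d |Ω|`; dividing by `t` finishes. The radius `R_M` may serve as `R` because
it is strictly larger than `M` when `M > 0` (`lt_momentumBound`). -/

noncomputable section

namespace HamiltonJacobi

/-! ### The Hamiltonian and its Legendre transform -/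

/-- The standing assumptions on the Hamiltonian. -/
structure Admissible {d : ℕ} (H : E d → ℝ) : Prop where
  contDiff : ContDiff ℝ 1 H
  coercive : Coercive H
  directional : UniformlyDirectionallyConvex H

variable {d : ℕ} {H : E d → ℝ}

lemma continuous_gradient {f : E d → ℝ} (hf : ContDiff ℝ 1 f) : Continuous (gradient f) :=
  (InnerProductSpace.toDual ℝ (E d)).symm.continuous.comp (hf.continuous_fderiv one_ne_zero)

lemma Admissible.exists_mul_norm_sub_le (hH : Admissible H) (K : ℝ) :
    ∃ C, ∀ p, K * ‖p‖ - C ≤ H p := by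
  have h1 : ∀ᶠ p in cocompact (E d), K * ‖p‖ ≤ H p := by
    rw [← Metric.cobounded_eq_cocompact]
    filter_upwards [hH.coercive.eventually_ge_atTop K,
      tendsto_norm_cobounded_atTop.eventually_gt_atTop 0] with p hp h0
    rwa [le_div_iff₀ h0] at hp
  obtain ⟨s, hs, hs'⟩ := mem_cocompact.1 h1
  obtain ⟨C, hC⟩ := (hs.image (f := fun p => K * ‖p‖ - H p)
    ((continuous_const.mul continuous_norm).sub hH.contDiff.continuous)).bddAbove
  refine ⟨max C 0, fun p => ?_⟩
  by_cases hp : p ∈ s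
  · have := hC (mem_image_of_mem _ hp)
    linarith [le_max_left C 0]
  · have := hs' hp
    simp only [mem_ofPred_eq] at this
    linarith [le_max_right C 0]

lemma Admissible.exists_isMax (hH : Admissible H) (q : E d) :
    ∃ p, ∀ p', inner ℝ p' q - H p' ≤ inner ℝ p q - H p := by
  obtain ⟨C, hC⟩ := hH.exists_mul_norm_sub_le (‖q‖ + 1)
  have hcont : Continuous fun p : E d => inner ℝ p q - H p :=
    (continuous_id.inner continuous_const).sub hH.contDiff.continuous
  refine hcont.exists_forall_ge ?_
  have h1 : Tendsto (fun p : E d => C - ‖p‖) (cocompact (E d)) atBot :=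
    tendsto_const_nhds.add_atBot (tendsto_neg_atTop_atBot.comp tendsto_norm_cocompact_atTop)
  refine tendsto_atBot_mono (fun p => ?_) h1
  have h2 := real_inner_le_norm p q
  have h3 := hC p
  nlinarith

lemma gradient_eq_of_isMax (hH : Admissible H) {p q : E d}
    (h : ∀ p', inner ℝ p' q - H p' ≤ inner ℝ p q - H p) : gradient H p = q := by
  have hd : DifferentiableAt ℝ H p := hH.contDiff.differentiable one_ne_zero p
  have h1 : HasFDerivAt (fun p' : E d => inner ℝ p' q - H p')
      (InnerProductSpace.toDual ℝ (E d) q - fderiv ℝ H p) p := by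
    refine HasFDerivAt.sub ?_ hd.hasFDerivAt
    simp_rw [real_inner_comm q]
    exact (InnerProductSpace.toDual ℝ (E d) q).hasFDerivAt
  have h2 := IsLocalMax.hasFDerivAt_eq_zero (Eventually.of_forall h) h1
  rw [sub_eq_zero] at h2
  rw [gradient, ← h2, LinearIsometryEquiv.symm_apply_apply]

lemma dirConvexityConst_le {R : ℝ} {p q : E d} (hp : ‖p‖ ≤ R) (hq : ‖q‖ ≤ R) (hpq : p ≠ q) :
    dirConvexityConst H R ≤ ENNReal.ofReal (inner ℝ
      (‖gradient H p - gradient H q‖⁻¹ • (gradient H p - gradient H q))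
      (‖p - q‖⁻¹ • (p - q))) := by
  unfold dirConvexityConst
  exact iInf₂_le_of_le p (by simpa using hp) (iInf₂_le_of_le q (by simpa using hq)
    (iInf_le_of_le hpq le_rfl))

lemma Admissible.dirConvexityConst_pos (hH : Admissible H) {R : ℝ} (hR : 0 < R) :
    0 < dirConvexityConst H R := hH.directional R hR

lemma dirConvexityConst_lt_top (hd : 0 < d) {R : ℝ} (hR : 0 < R) :
    dirConvexityConst H R < ∞ := by
  have : Nontrivial (E d) := by
    have : Nonempty (Fin d) := ⟨⟨0, hd⟩⟩
    infer_instance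
  obtain ⟨p, hp⟩ := exists_norm_eq (E d) hR.le
  have h0 : p ≠ 0 := by rw [← norm_pos_iff, hp]; exact hR
  exact (dirConvexityConst_le hp.le (by simpa using hR.le) h0).trans_lt ENNReal.ofReal_lt_top

/-- Take `R = |p| + |q|`, so that both points lie in the ball. Since `dirConvexityConst` truncates
negative values to `0`, its positivity forces the inner product itself to be positive. -/
lemma inner_gradient_sub_pos (hH : Admissible H) {p q : E d} (hpq : p ≠ q) :
    0 < inner ℝ (gradient H p - gradient H q) (p - q) := by
  have hR : 0 < ‖p‖ + ‖q‖ := by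
    rcases eq_or_ne p 0 with rfl | hp
    · simpa using hpq.symm
    · have := norm_pos_iff.2 hp; positivity
  have h1 := (hH.dirConvexityConst_pos hR).trans_le
    (dirConvexityConst_le (le_add_of_nonneg_right (norm_nonneg q))
      (le_add_of_nonneg_left (norm_nonneg p)) hpq)
  rw [ENNReal.ofReal_pos, real_inner_smul_left, real_inner_smul_right] at h1
  exact pos_of_mul_pos_right (pos_of_mul_pos_right h1 (by positivity)) (by positivity)

lemma inner_gradient_sub_ge (hH : Admissible H) {R : ℝ} {p q : E d} (hp : ‖p‖ ≤ R)
    (hq : ‖q‖ ≤ R) :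
    (dirConvexityConst H R).toReal * (‖gradient H p - gradient H q‖ * ‖p - q‖) ≤
      inner ℝ (gradient H p - gradient H q) (p - q) := by
  rcases eq_or_ne p q with rfl | hpq
  · simp
  have h0 := inner_gradient_sub_pos hH hpq
  have hg' : 0 < ‖gradient H p - gradient H q‖ := by
    rw [norm_pos_iff]; intro h; simp [h] at h0
  have hp' : 0 < ‖p - q‖ := norm_pos_iff.2 (sub_ne_zero.2 hpq)
  have h1 := dirConvexityConst_le (H := H) hp hq hpq
  rw [real_inner_smul_left, real_inner_smul_right] at h1
  have h2 := ENNReal.toReal_mono ENNReal.ofReal_ne_top h1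
  rw [ENNReal.toReal_ofReal (by positivity)] at h2
  calc _ ≤ _ := mul_le_mul_of_nonneg_right h2 (by positivity)
    _ = _ := by field_simp

lemma gradient_injective (hH : Admissible H) : Function.Injective (gradient H) := by
  intro p q h
  by_contra hpq
  have := inner_gradient_sub_pos hH hpq
  simp [h] at this

/-- Plays the role of the convexity inequality. Some `p₀` maximizes `⟨·, DH(p)⟩ - H`, it satisfies
`DH(p₀) = DH(p)`, and injectivity identifies it with `p`. -/
lemma isMax_gradient (hH : Admissible H) (p p' : E d) :
    inner ℝ p' (gradient H p) - H p' ≤ inner ℝ p (gradient H p) - H p := by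
  obtain ⟨p₀, h⟩ := hH.exists_isMax (gradient H p)
  rw [← gradient_injective hH (gradient_eq_of_isMax hH h)]
  rw [gradient_eq_of_isMax hH h]
  exact h p'

lemma gradient_surjective (hH : Admissible H) : Function.Surjective (gradient H) := fun q =>
  let ⟨p, h⟩ := hH.exists_isMax q
  ⟨p, gradient_eq_of_isMax hH h⟩

/-- If `|DH(p)| < K`, maximality of `p` tested against `0` gives `H(p) ≤ H(0) + K|p|`, which
superlinear growth excludes for large `p`. Properness makes the continuous bijection `DH` closed,
hence a homeomorphism. -/
lemma tendsto_gradient_cocompact (hH : Admissible H) :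
    Tendsto (gradient H) (cocompact (E d)) (cocompact (E d)) := by
  rw [← Metric.cobounded_eq_cocompact, ← tendsto_norm_atTop_iff_cobounded]
  refine tendsto_atTop.2 fun K => ?_
  obtain ⟨C, hC⟩ := hH.exists_mul_norm_sub_le (K + 1)
  filter_upwards [tendsto_norm_cobounded_atTop.eventually_gt_atTop (C + H 0)] with p hp
  by_contra! hlt
  have h1 := isMax_gradient hH p 0
  have h2 := real_inner_le_norm p (gradient H p)
  have h3 := hC p
  have h4 : ‖p‖ * ‖gradient H p‖ ≤ ‖p‖ * K :=
    mul_le_mul_of_nonneg_left hlt.le (norm_nonneg _)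
  rw [inner_zero_left] at h1
  nlinarith

/-- The gradient of the Hamiltonian as a homeomorphism. -/
def gradientHomeomorph (hH : Admissible H) : E d ≃ₜ E d :=
  (Equiv.ofBijective (gradient H)
    ⟨gradient_injective hH, gradient_surjective hH⟩).toHomeomorphOfContinuousClosed
    (continuous_gradient hH.contDiff)
    (isProperMap_iff_tendsto_cocompact.2
      ⟨continuous_gradient hH.contDiff, tendsto_gradient_cocompact hH⟩).isClosedMap

lemma gradientHomeomorph_apply (hH : Admissible H) (p : E d) :
    gradientHomeomorph hH p = gradient H p := rfl

lemma gradient_gradientHomeomorph_symm (hH : Admissible H) (q : E d) :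
    gradient H ((gradientHomeomorph hH).symm q) = q :=
  (gradientHomeomorph hH).apply_symm_apply q

lemma bddAbove_legendre (hH : Admissible H) (q : E d) :
    BddAbove (range fun p : E d => inner ℝ p q - H p) := by
  obtain ⟨p, h⟩ := hH.exists_isMax q
  exact ⟨_, forall_mem_range.2 h⟩

lemma le_legendre (hH : Admissible H) (p q : E d) : inner ℝ p q - H p ≤ legendre H q :=
  le_ciSup (bddAbove_legendre hH q) p

lemma legendre_gradient (hH : Admissible H) (p : E d) :
    legendre H (gradient H p) = inner ℝ p (gradient H p) - H p :=
  le_antisymm (ciSup_le (isMax_gradient hH p)) (le_legendre hH p _)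

/-- With `P = (DH)⁻¹`, testing each supremum at the other's maximizer traps `L(q') - L(q) - ⟨P q, q'
- q⟩` between `0` and `⟨P q' - P q, q' - q⟩`, which is `o(|q' - q|)` by continuity of `P`. -/
lemma hasGradientAt_legendre_aux (hH : Admissible H) (q : E d) :
    HasGradientAt (legendre H) ((gradientHomeomorph hH).symm q) q := by
  set P := (gradientHomeomorph hH).symm
  have hP : ∀ q, legendre H q = inner ℝ (P q) q - H (P q) := fun q => by
    have := legendre_gradient hH (P q)
    rwa [gradient_gradientHomeomorph_symm] at this
  rw [hasGradientAt_iff_isLittleO, Asymptotics.isLittleO_iff]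
  intro ε hε
  have h1 : ∀ᶠ q' in 𝓝 q, ‖P q' - P q‖ < ε := by
    have := (P.continuous.tendsto q).eventually (Metric.ball_mem_nhds _ hε)
    simpa [dist_eq_norm] using this
  filter_upwards [h1] with q' hq'
  have h2 := le_legendre hH (P q) q'
  have h3 := le_legendre hH (P q') q
  have h4 := hP q
  have h5 := hP q'
  have h6 : |inner ℝ (P q' - P q) (q' - q)| ≤ ε * ‖q' - q‖ :=
    (abs_real_inner_le_norm _ _).trans (mul_le_mul_of_nonneg_right hq'.le (norm_nonneg _))
  rw [inner_sub_left, inner_sub_right, inner_sub_right] at h6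
  have h7 := abs_le.1 h6
  rw [Real.norm_eq_abs, inner_sub_right, abs_le]
  constructor <;> linarith [h7.1, h7.2]

lemma gradient_legendre (hH : Admissible H) (q : E d) :
    gradient (legendre H) q = (gradientHomeomorph hH).symm q :=
  (hasGradientAt_legendre_aux hH q).gradient

lemma hasGradientAt_legendre (hH : Admissible H) (q : E d) :
    HasGradientAt (legendre H) (gradient (legendre H) q) q := by
  rw [gradient_legendre hH]; exact hasGradientAt_legendre_aux hH q

lemma continuous_gradient_legendre (hH : Admissible H) : Continuous (gradient (legendre H)) := by
  rw [funext (gradient_legendre hH)]; exact (gradientHomeomorph hH).symm.continuous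

lemma gradient_gradient_legendre (hH : Admissible H) (q : E d) :
    gradient H (gradient (legendre H) q) = q := by
  rw [gradient_legendre hH, gradient_gradientHomeomorph_symm]

lemma gradient_legendre_gradient (hH : Admissible H) (p : E d) :
    gradient (legendre H) (gradient H p) = p := by
  rw [gradient_legendre hH, ← gradientHomeomorph_apply hH, Homeomorph.symm_apply_apply]

lemma continuous_legendre (hH : Admissible H) : Continuous (legendre H) :=
  continuous_iff_continuousAt.2 fun q => (hasGradientAt_legendre hH q).continuousAt

lemma legendre_eq (hH : Admissible H) (q : E d) :
    legendre H q = inner ℝ (gradient (legendre H) q) q - H (gradient (legendre H) q) := by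
  have := legendre_gradient hH (gradient (legendre H) q)
  rwa [gradient_gradient_legendre hH] at this

lemma exists_mul_norm_sub_le_legendre (hH : Admissible H) (K : ℝ) :
    ∃ C, ∀ q, K * ‖q‖ - C ≤ legendre H q := by
  obtain ⟨C, hC⟩ := ((isCompact_closedBall (0 : E d) |K|).image hH.contDiff.continuous).bddAbove
  refine ⟨C, fun q => ?_⟩
  -- Test the supremum at the vector of length `|K|` along `q`; for `q = 0` the convention `0⁻¹ = 0`
  -- makes it the zero vector.
  have h := le_legendre hH ((K * ‖q‖⁻¹) • q) q
  rw [real_inner_smul_left, real_inner_self_eq_norm_sq] at h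
  have h1 : H ((K * ‖q‖⁻¹) • q) ≤ C := by
    refine hC (mem_image_of_mem _ ?_)
    rw [mem_closedBall_zero_iff, norm_smul, norm_mul, norm_inv, norm_norm, mul_assoc]
    exact mul_le_of_le_one_right (norm_nonneg K) inv_mul_le_one
  have h2 : K * ‖q‖⁻¹ * ‖q‖ ^ 2 = K * ‖q‖ := by
    rcases eq_or_ne ‖q‖ 0 with h0 | h0
    · simp [h0]
    · field_simp
  linarith

/-! ### The Hopf-Lax solution -/

section HopfLax

variable {d : ℕ} {H : E d → ℝ} {u₀ : E d → ℝ} {M : ℝ≥0} {t : ℝ}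

/-- The quantity minimized over `y` in the Hopf-Lax formula. -/
def cost (H u₀ : E d → ℝ) (t : ℝ) (x y : E d) : ℝ := u₀ y + t * legendre H (t⁻¹ • (x - y))

/-- The foot of the backward ray through `x` with slope `slope H u₀ t x`. -/
def foot (H u₀ : E d → ℝ) (t : ℝ) (x : E d) : E d := x - t • slope H u₀ t x

lemma continuous_cost (hH : Admissible H) (hu₀ : LipschitzWith M u₀) :
    Continuous fun z : E d × E d => cost H u₀ t z.1 z.2 :=
  (hu₀.continuous.comp continuous_snd).add (continuous_const.mul
    ((continuous_legendre hH).comp ((continuous_fst.sub continuous_snd).const_smul t⁻¹)))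

lemma exists_forall_cost_le (hH : Admissible H) (hu₀ : LipschitzWith M u₀) (ht : 0 < t)
    (x : E d) : ∃ y, ∀ y', cost H u₀ t x y ≤ cost H u₀ t x y' := by
  have hcont : Continuous (cost H u₀ t x) :=
    (continuous_cost hH hu₀).comp (Continuous.prodMk_right x)
  refine hcont.exists_forall_le ?_
  obtain ⟨C, hC⟩ := exists_mul_norm_sub_le_legendre hH (M + 1)
  have h1 : Tendsto (fun y : E d => (u₀ x - ‖x‖ - t * C) + ‖y‖) (cocompact (E d)) atTop :=
    tendsto_const_nhds.add_atTop tendsto_norm_cocompact_atTop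
  refine tendsto_atTop_mono (fun y => ?_) h1
  have h2 := hu₀.dist_le_mul x y
  rw [Real.dist_eq, dist_eq_norm] at h2
  have h3 := mul_le_mul_of_nonneg_left (hC (t⁻¹ • (x - y))) ht.le
  rw [norm_smul, Real.norm_eq_abs, abs_of_pos (inv_pos.2 ht)] at h3
  have h4 : t * ((M + 1) * (t⁻¹ * ‖x - y‖) - C) = (M + 1) * ‖x - y‖ - t * C := by field_simp
  have h5 : ‖y‖ - ‖x‖ ≤ ‖x - y‖ := by rw [norm_sub_rev]; exact norm_sub_norm_le y x
  unfold cost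
  linarith [(abs_le.1 h2).2]

lemma hopfLax_eq_of_forall_le {x y : E d} (h : ∀ y', cost H u₀ t x y ≤ cost H u₀ t x y') :
    hopfLax H u₀ t x = cost H u₀ t x y :=
  le_antisymm (ciInf_le ⟨cost H u₀ t x y, forall_mem_range.2 h⟩ y) (le_ciInf h)

lemma exists_hopfLax_eq (hH : Admissible H) (hu₀ : LipschitzWith M u₀) (ht : 0 < t) (x : E d) :
    ∃ y, hopfLax H u₀ t x = cost H u₀ t x y :=
  let ⟨y, hy⟩ := exists_forall_cost_le hH hu₀ ht x
  ⟨y, hopfLax_eq_of_forall_le hy⟩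

lemma hopfLax_le (hH : Admissible H) (hu₀ : LipschitzWith M u₀) (ht : 0 < t) (x y : E d) :
    hopfLax H u₀ t x ≤ cost H u₀ t x y := by
  obtain ⟨y₀, h⟩ := exists_forall_cost_le hH hu₀ ht x
  exact (hopfLax_eq_of_forall_le h).trans_le (h y)

lemma lipschitzWith_hopfLax (hH : Admissible H) (hu₀ : LipschitzWith M u₀) (ht : 0 < t) :
    LipschitzWith M (hopfLax H u₀ t) := by
  refine LipschitzWith.of_le_add_mul M fun x' x => ?_
  obtain ⟨y, hy⟩ := exists_hopfLax_eq hH hu₀ ht x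
  -- Translating the minimizer along with `x` leaves the Legendre term unchanged, so only `u₀`
  -- varies.
  have h1 := hopfLax_le hH hu₀ ht x' (y + (x' - x))
  have h2 := hu₀.dist_le_mul (y + (x' - x)) y
  rw [Real.dist_eq, dist_eq_norm, add_sub_cancel_left, ← dist_eq_norm] at h2
  unfold cost at h1 hy
  rw [show x' - (y + (x' - x)) = x - y by abel] at h1
  linarith [(abs_le.1 h2).2]

lemma norm_gradient_hopfLax_le (hH : Admissible H) (hu₀ : LipschitzWith M u₀) (ht : 0 < t)
    (x : E d) : ‖gradient (hopfLax H u₀ t) x‖ ≤ M := by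
  rw [gradient, LinearIsometryEquiv.norm_map]
  exact norm_fderiv_le_of_lipschitz ℝ (lipschitzWith_hopfLax hH hu₀ ht)

lemma hasFDerivAt_cost (hH : Admissible H) (ht : 0 < t) (x y : E d) :
    HasFDerivAt (fun x => cost H u₀ t x y)
      (innerSL ℝ (gradient (legendre H) (t⁻¹ • (x - y)))) x := by
  have h1 : HasFDerivAt (fun x : E d => t⁻¹ • (x - y)) (t⁻¹ • ContinuousLinearMap.id ℝ (E d)) x :=
    ((hasFDerivAt_id x).sub_const y).const_smul t⁻¹
  have h2 := (((hasGradientAt_legendre hH (t⁻¹ • (x - y))).hasFDerivAt.comp x h1).const_mul t)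
  refine (h2.const_add (u₀ y)).congr_fderiv ?_
  ext v
  simp [ht.ne']

/-- The function `u(t,·) - cost(·, y)` is nonpositive and vanishes at `x`, so its derivative there
is zero. -/
lemma gradient_hopfLax_eq (hH : Admissible H) (hu₀ : LipschitzWith M u₀) (ht : 0 < t) {x y : E d}
    (hx : DifferentiableAt ℝ (hopfLax H u₀ t) x) (hy : hopfLax H u₀ t x = cost H u₀ t x y) :
    gradient (hopfLax H u₀ t) x = gradient (legendre H) (t⁻¹ • (x - y)) := by
  have h1 := hx.hasFDerivAt.sub (hasFDerivAt_cost (u₀ := u₀) hH ht x y)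
  have h2 : IsLocalMax (hopfLax H u₀ t - fun x => cost H u₀ t x y) x :=
    Eventually.of_forall fun x' => by
      simp only [Pi.sub_apply, hy, sub_self, sub_nonpos]
      exact hopfLax_le hH hu₀ ht x' y
  have h3 := sub_eq_zero.1 (h2.hasFDerivAt_eq_zero h1)
  rw [gradient, h3]
  exact (InnerProductSpace.toDual ℝ (E d)).symm_apply_apply _

lemma eq_foot (hH : Admissible H) (hu₀ : LipschitzWith M u₀) (ht : 0 < t) {x y : E d}
    (hx : DifferentiableAt ℝ (hopfLax H u₀ t) x) (hy : hopfLax H u₀ t x = cost H u₀ t x y) :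
    y = foot H u₀ t x := by
  rw [foot, slope, gradient_hopfLax_eq hH hu₀ ht hx hy, gradient_gradient_legendre hH,
    smul_inv_smul₀ ht.ne', sub_sub_cancel]

lemma hopfLax_eq_cost_foot (hH : Admissible H) (hu₀ : LipschitzWith M u₀) (ht : 0 < t) {x : E d}
    (hx : DifferentiableAt ℝ (hopfLax H u₀ t) x) :
    hopfLax H u₀ t x = cost H u₀ t x (foot H u₀ t x) := by
  obtain ⟨y, hy⟩ := exists_hopfLax_eq hH hu₀ ht x
  rwa [← eq_foot hH hu₀ ht hx hy]

lemma inv_smul_sub_foot (ht : 0 < t) (x : E d) :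
    t⁻¹ • (x - foot H u₀ t x) = slope H u₀ t x := by
  rw [foot, sub_sub_cancel, inv_smul_smul₀ ht.ne']

lemma backwardSlopes_eq (hH : Admissible H) (hu₀ : LipschitzWith M u₀) (ht : 0 < t) {x : E d}
    (hx : DifferentiableAt ℝ (hopfLax H u₀ t) x) :
    backwardSlopes H u₀ t x = {slope H u₀ t x} := by
  ext v
  constructor
  · rintro ⟨y, rfl, hy⟩
    rw [eq_foot hH hu₀ ht hx hy]
    exact inv_smul_sub_foot ht x
  · rintro rfl
    exact ⟨foot H u₀ t x, (inv_smul_sub_foot ht x).symm, hopfLax_eq_cost_foot hH hu₀ ht hx⟩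

lemma ae_differentiableAt_hopfLax (hH : Admissible H) (hu₀ : LipschitzWith M u₀) (ht : 0 < t) :
    ∀ᵐ x : E d, DifferentiableAt ℝ (hopfLax H u₀ t) x :=
  (lipschitzWith_hopfLax hH hu₀ ht).ae_differentiableAt

lemma measurable_slope (hH : Admissible H) : Measurable (slope H u₀ t) :=
  (continuous_gradient hH.contDiff).measurable.comp
    ((InnerProductSpace.toDual ℝ (E d)).symm.continuous.measurable.comp (measurable_fderiv ℝ _))

lemma measurable_foot (hH : Admissible H) : Measurable (foot H u₀ t) :=
  measurable_id.sub ((measurable_slope hH).const_smul t)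

lemma exists_norm_slope_le (hH : Admissible H) (hu₀ : LipschitzWith M u₀) (ht : 0 < t) :
    ∃ B, ∀ x, ‖slope H u₀ t x‖ ≤ B := by
  obtain ⟨B, hB⟩ := ((isCompact_closedBall (0 : E d) M).image
    (continuous_gradient hH.contDiff).norm).bddAbove
  exact ⟨B, fun x => hB (mem_image_of_mem _
    (by simpa using norm_gradient_hopfLax_le hH hu₀ ht x))⟩

end HopfLax

/-! ### Integration by parts and parametric integrals -/

section Calculus

variable {d : ℕ}

/-- The functional `A ↦ tr (Cᵀ A)` on linear maps. -/
def pairing (C : E d →L[ℝ] E d) : (E d →L[ℝ] E d) →L[ℝ] ℝ :=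
  ∑ j, innerSL ℝ (C (EuclideanSpace.single j 1)) ∘L
    ContinuousLinearMap.apply ℝ (E d) (EuclideanSpace.single j 1)

lemma pairing_apply (C A : E d →L[ℝ] E d) :
    pairing C A =
      ∑ j, inner ℝ (C (EuclideanSpace.single j 1)) (A (EuclideanSpace.single j 1)) := by
  simp [pairing]

lemma pairing_add (C C' A : E d →L[ℝ] E d) : pairing (C + C') A = pairing C A + pairing C' A := by
  simp [pairing_apply, inner_add_left, Finset.sum_add_distrib]

lemma pairing_smul (c : ℝ) (C A : E d →L[ℝ] E d) : pairing (c • C) A = c * pairing C A := by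
  simp [pairing_apply, inner_smul_left, Finset.mul_sum]

lemma sum_smul_single (l : E d →L[ℝ] ℝ) :
    ∑ j, l (EuclideanSpace.single j 1) • (EuclideanSpace.single j 1 : E d) =
      (InnerProductSpace.toDual ℝ (E d)).symm l := by
  have h := (EuclideanSpace.basisFun (Fin d) ℝ).sum_repr'
    ((InnerProductSpace.toDual ℝ (E d)).symm l)
  rw [← h]
  refine Finset.sum_congr rfl fun j _ => ?_
  rw [real_inner_comm, InnerProductSpace.toDual_symm_apply]
  simp

/-- Turns the trace pairing with a rank-one map into a single inner product; this is how derivatives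
of scalar weights and test functions enter. -/
lemma pairing_smulRight (C : E d →L[ℝ] E d) (l : E d →L[ℝ] ℝ) (a : E d) :
    pairing C (l.smulRight a) = inner ℝ (C ((InnerProductSpace.toDual ℝ (E d)).symm l)) a := by
  rw [pairing_apply, ← sum_smul_single, map_sum, sum_inner]
  refine Finset.sum_congr rfl fun j _ => ?_
  rw [ContinuousLinearMap.smulRight_apply, map_smul, inner_smul_right, real_inner_smul_left]

lemma divergence_eq_pairing (φ : E d → E d) (x : E d) :
    divergence φ x = pairing (ContinuousLinearMap.id ℝ (E d)) (fderiv ℝ φ x) := by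
  rw [pairing_apply, divergence]
  refine Finset.sum_congr rfl fun j _ => ?_
  simp [EuclideanSpace.inner_single_left]

lemma integral_pairing_fderiv (C : E d →L[ℝ] E d) {G : E d → E d} (hG : ContDiff ℝ 1 G)
    (hc : HasCompactSupport G) : ∫ x, pairing C (fderiv ℝ G x) = 0 := by
  have hi : ∀ j : Fin d, Integrable fun x => inner ℝ (C (EuclideanSpace.single j 1))
      (fderiv ℝ G x (EuclideanSpace.single j 1)) := fun j => by
    refine Continuous.integrable_of_hasCompactSupport ?_ ?_
    · exact continuous_const.inner ((hG.continuous_fderiv one_ne_zero).clm_apply continuous_const)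
    · refine (hc.fderiv ℝ).comp_left (g := fun A : E d →L[ℝ] E d =>
        inner ℝ (C (EuclideanSpace.single j 1)) (A (EuclideanSpace.single j 1))) ?_
      simp
  simp_rw [pairing_apply]
  rw [integral_finsetSum _ fun j _ => hi j]
  refine Finset.sum_eq_zero fun j _ => ?_
  set v := C (EuclideanSpace.single j 1)
  have hg : ∀ x, fderiv ℝ (fun x => inner ℝ v (G x)) x (EuclideanSpace.single j 1) =
      inner ℝ v (fderiv ℝ G x (EuclideanSpace.single j 1)) := fun x => by
    have h1 := (innerSL ℝ v).hasFDerivAt.comp x ((hG.differentiable one_ne_zero) x).hasFDerivAt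
    have h2 : HasFDerivAt (fun x => inner ℝ v (G x)) ((innerSL ℝ v).comp (fderiv ℝ G x)) x := h1
    rw [h2.fderiv]
    simp
  have hd : ContDiff ℝ 1 fun x => inner ℝ v (G x) := contDiff_const.inner ℝ hG
  have hgi : Integrable fun x => inner ℝ v (G x) :=
    hd.continuous.integrable_of_hasCompactSupport
      (hc.comp_left (g := fun y : E d => inner ℝ v y) (by simp))
  have h := integral_mul_fderiv_eq_neg_fderiv_mul_of_integrable (μ := volume) (𝕜 := ℝ)
    (f := fun _ : E d => (1 : ℝ)) (g := fun x => inner ℝ v (G x)) (v := EuclideanSpace.single j 1)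
    (by simp) (by simpa [hg] using hi j) (by simpa using hgi)
    (fun x _ => differentiableAt_const _) (fun x _ => (hd.differentiable one_ne_zero) x)
  simpa [hg] using h

lemma integral_mul_pairing_fderiv (C : E d →L[ℝ] E d) {η : E d → ℝ} {F : E d → E d}
    (hη : ContDiff ℝ 1 η) (hF : ContDiff ℝ 1 F) (hc : HasCompactSupport η ∨ HasCompactSupport F) :
    ∫ x, η x * pairing C (fderiv ℝ F x) = -∫ x, pairing C ((fderiv ℝ η x).smulRight (F x)) := by
  have hG : HasCompactSupport fun x => η x • F x := by
    rcases hc with h | h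
    · exact h.mono' fun x hx =>
        subset_tsupport _ (Function.mem_support.2 fun h0 => hx (by simp [h0]))
    · exact h.mono' fun x hx =>
        subset_tsupport _ (Function.mem_support.2 fun h0 => hx (by simp [h0]))
  have h0 : ∫ x, pairing C (fderiv ℝ (fun x => η x • F x) x) = 0 :=
    integral_pairing_fderiv C (hη.smul hF) hG
  have h1 : ∀ x, fderiv ℝ (fun x => η x • F x) x =
      η x • fderiv ℝ F x + (fderiv ℝ η x).smulRight (F x) := fun x =>
    fderiv_fun_smul ((hη.differentiable one_ne_zero) x) ((hF.differentiable one_ne_zero) x)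
  simp_rw [h1, map_add, map_smul, smul_eq_mul] at h0
  have hc1 : Continuous fun x => η x * pairing C (fderiv ℝ F x) :=
    hη.continuous.mul ((pairing C).continuous.comp (hF.continuous_fderiv one_ne_zero))
  have hc2 : Continuous fun x => pairing C ((fderiv ℝ η x).smulRight (F x)) := by
    refine (pairing C).continuous.comp ?_
    exact (ContinuousLinearMap.smulRightL ℝ (E d) (E d)).isBoundedBilinearMap.continuous.comp
      ((hη.continuous_fderiv one_ne_zero).prodMk hF.continuous)
  have hs1 : HasCompactSupport fun x => η x * pairing C (fderiv ℝ F x) := by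
    rcases hc with h | h
    · exact h.mul_right
    · exact ((h.fderiv ℝ).comp_left (map_zero (pairing C))).mul_left
  have hs2 : HasCompactSupport fun x => pairing C ((fderiv ℝ η x).smulRight (F x)) := by
    rcases hc with h | h
    · exact (h.fderiv ℝ).mono' fun x hx =>
        subset_tsupport _ (Function.mem_support.2 fun h0 => hx (by simp [h0]))
    · exact h.mono' fun x hx =>
        subset_tsupport _ (Function.mem_support.2 fun h0 => hx (by simp [h0]))
  rw [integral_add (hc1.integrable_of_hasCompactSupport hs1)
    (hc2.integrable_of_hasCompactSupport hs2)] at h0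
  linarith

lemma hasFDerivAt_setIntegral_of_isCompact {V W : Type*} [NormedAddCommGroup V] [NormedSpace ℝ V]
    [NormedAddCommGroup W] [NormedSpace ℝ W]
    [SecondCountableTopology W] [FiniteDimensional ℝ V] [CompleteSpace W]
    {K : Set (E d)} (hK : IsCompact K) {f : V → E d → W} {f' : V → E d → V →L[ℝ] W}
    (hf : Continuous f.uncurry) (hf' : Continuous f'.uncurry)
    (h : ∀ x y, HasFDerivAt (fun x => f x y) (f' x y) x) (x : V) :
    HasFDerivAt (fun x => ∫ y in K, f x y) (∫ y in K, f' x y) x := by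
  obtain ⟨B, hB⟩ := ((isCompact_closedBall x 1).prod hK).bddAbove_image hf'.norm.continuousOn
  have hc : ∀ x, Continuous (f x) := fun x => hf.comp (Continuous.prodMk_right x)
  have hc' : ∀ x, Continuous (f' x) := fun x => hf'.comp (Continuous.prodMk_right x)
  refine hasFDerivAt_integral_of_dominated_of_fderiv_le (bound := fun _ => B)
    (Metric.closedBall_mem_nhds x one_pos)
    (Eventually.of_forall fun x => (hc x).aestronglyMeasurable)
    ((hc x).continuousOn.integrableOn_compact hK)
    (hc' x).aestronglyMeasurable ?_ ?_ (Eventually.of_forall fun y x _ => h x y)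
  · refine (ae_restrict_iff' hK.measurableSet).2 (Eventually.of_forall fun y hy x hx => ?_)
    exact hB (mem_image_of_mem (fun z : V × E d => ‖f'.uncurry z‖) (mk_mem_prod hx hy))
  · exact integrableOn_const hK.measure_lt_top.ne

end Calculus

/-! ### Gibbs averages of the backward feet -/

section Gibbs

variable {d : ℕ}

lemma pairing_toDual_smulRight (C : E d →L[ℝ] E d) (c : ℝ) (p a : E d) :
    pairing C ((c • innerSL ℝ p).smulRight a) = c * inner ℝ (C p) a := by
  have h : (c • innerSL ℝ p).smulRight a =
      c • (InnerProductSpace.toDual ℝ (E d) p : E d →L[ℝ] ℝ).smulRight a := by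
    ext v; simp [mul_assoc]
  rw [h, map_smul, pairing_smulRight, LinearIsometryEquiv.symm_apply_apply, smul_eq_mul]

lemma setIntegral_mul_inner {K : Set (E d)} (hK : IsCompact K) {w : E d → ℝ} {y : E d → E d}
    (hw : Continuous w) (hy : Continuous y) (v : E d) :
    ∫ a in K, w a * inner ℝ v (y a) = inner ℝ v (∫ a in K, w a • y a) := by
  have hi : IntegrableOn (fun a => w a • y a) K :=
    (hw.smul hy).continuousOn.integrableOn_compact hK
  rw [← integral_inner hi]
  simp only [inner_smul_right]

/-- Chebyshev's association inequality: expanding `∬ w(a) w(b) ⟨q a - q b, y a - y b⟩ ≤ 0` gives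
twice the difference of the two sides. -/
lemma integral_mul_integral_inner_le {K : Set (E d)} (hK : IsCompact K) {w : E d → ℝ}
    {q y : E d → E d} (hw : Continuous w) (hq : Continuous q) (hy : Continuous y)
    (hw0 : ∀ a, 0 ≤ w a) (h : ∀ a ∈ K, ∀ b ∈ K, inner ℝ (q a - q b) (y a - y b) ≤ 0) :
    (∫ a in K, w a) * ∫ a in K, w a * inner ℝ (q a) (y a) ≤
      inner ℝ (∫ a in K, w a • q a) (∫ a in K, w a • y a) := by
  have hI : ∀ {W : Type} [NormedAddCommGroup W] {f : E d → W},
      Continuous f → IntegrableOn f K := fun hf => hf.continuousOn.integrableOn_compact hK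
  set Z := ∫ a in K, w a
  set S := ∫ a in K, w a * inner ℝ (q a) (y a)
  set Q := ∫ a in K, w a • q a with hQ
  set N := ∫ a in K, w a • y a with hN
  have hNi : ∀ v, ∫ a in K, w a * inner ℝ v (y a) = inner ℝ v N :=
    setIntegral_mul_inner hK hw hy
  have hQi : ∀ v, ∫ a in K, w a * inner ℝ (q a) v = inner ℝ Q v := fun v => by
    simpa only [real_inner_comm] using setIntegral_mul_inner hK hw hq v
  have h1 : ∀ a ∈ K, inner ℝ (q a) (y a) * Z - inner ℝ (q a) N - inner ℝ Q (y a) + S ≤ 0 := by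
    intro a ha
    have h2 : ∫ b in K, w b * inner ℝ (q a - q b) (y a - y b) ≤ 0 :=
      setIntegral_nonpos hK.measurableSet fun b hb =>
        mul_nonpos_of_nonneg_of_nonpos (hw0 b) (h a ha b hb)
    have h3 : ∀ b, w b * inner ℝ (q a - q b) (y a - y b) =
        w b * inner ℝ (q a) (y a) - w b * inner ℝ (q a) (y b) - w b * inner ℝ (q b) (y a)
          + w b * inner ℝ (q b) (y b) := fun b => by
      rw [inner_sub_left, inner_sub_right, inner_sub_right]; ring
    simp_rw [h3] at h2
    rw [integral_add (hI (by fun_prop)) (hI (by fun_prop)),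
      integral_sub (hI (by fun_prop)) (hI (by fun_prop)),
      integral_sub (hI (by fun_prop)) (hI (by fun_prop)), hNi, hQi, integral_mul_const] at h2
    linarith
  have h4 : ∫ a in K, w a * (inner ℝ (q a) (y a) * Z - inner ℝ (q a) N - inner ℝ Q (y a) + S)
      ≤ 0 := setIntegral_nonpos hK.measurableSet fun a ha =>
        mul_nonpos_of_nonneg_of_nonpos (hw0 a) (h1 a ha)
  have h5 : ∀ a, w a * (inner ℝ (q a) (y a) * Z - inner ℝ (q a) N - inner ℝ Q (y a) + S) =
      w a * inner ℝ (q a) (y a) * Z - w a * inner ℝ (q a) N - w a * inner ℝ Q (y a) + w a * S :=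
    fun a => by ring
  simp_rw [h5] at h4
  rw [integral_add (hI (by fun_prop)) (hI (by fun_prop)),
    integral_sub (hI (by fun_prop)) (hI (by fun_prop)),
    integral_sub (hI (by fun_prop)) (hI (by fun_prop)), hNi, hQi, integral_mul_const,
    integral_mul_const] at h4
  linarith

variable {H : E d → ℝ} {u₀ : E d → ℝ} {M : ℝ≥0} {t : ℝ}

/-- The Gibbs weight `exp(-n g(x,y))`, with `g` the Hopf-Lax cost. -/
def gibbsWeight (H u₀ : E d → ℝ) (t : ℝ) (n : ℕ) (x y : E d) : ℝ :=
  Real.exp (-(n * cost H u₀ t x y))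

/-- The mean of `y` over `K` under the Gibbs weight. -/
def gibbsMean (H u₀ : E d → ℝ) (t : ℝ) (K : Set (E d)) (n : ℕ) (x : E d) : E d :=
  (∫ y in K, gibbsWeight H u₀ t n x y)⁻¹ • ∫ y in K, gibbsWeight H u₀ t n x y • y

lemma continuous_gibbsWeight (hH : Admissible H) (hu₀ : LipschitzWith M u₀) (n : ℕ) :
    Continuous fun z : E d × E d => gibbsWeight H u₀ t n z.1 z.2 :=
  Real.continuous_exp.comp (continuous_const.mul (continuous_cost hH hu₀)).neg

lemma hasFDerivAt_gibbsWeight (hH : Admissible H) (ht : 0 < t) (n : ℕ) (x y : E d) :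
    HasFDerivAt (fun x => gibbsWeight H u₀ t n x y)
      ((-n * gibbsWeight H u₀ t n x y) •
        innerSL ℝ (gradient (legendre H) (t⁻¹ • (x - y)))) x := by
  refine (((hasFDerivAt_cost (u₀ := u₀) hH ht x y).const_mul (n : ℝ)).neg.exp).congr_fderiv ?_
  ext v
  simp [gibbsWeight]
  ring

/-- The derivative of the Gibbs weight in `x`. -/
def gibbsWeight' (H u₀ : E d → ℝ) (t : ℝ) (n : ℕ) (x y : E d) : E d →L[ℝ] ℝ :=
  (-n * gibbsWeight H u₀ t n x y) • innerSL ℝ (gradient (legendre H) (t⁻¹ • (x - y)))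

lemma continuous_gibbsWeight' (hH : Admissible H) (hu₀ : LipschitzWith M u₀) (n : ℕ) :
    Continuous fun z : E d × E d => gibbsWeight' H u₀ t n z.1 z.2 :=
  (continuous_const.mul (continuous_gibbsWeight hH hu₀ n)).smul ((innerSL ℝ).continuous.comp
    ((continuous_gradient_legendre hH).comp ((continuous_fst.sub continuous_snd).const_smul t⁻¹)))

lemma continuous_gibbsWeight'_smulRight (hH : Admissible H) (hu₀ : LipschitzWith M u₀) (n : ℕ) :
    Continuous fun z : E d × E d => (gibbsWeight' H u₀ t n z.1 z.2).smulRight z.2 :=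
  (ContinuousLinearMap.smulRightL ℝ (E d) (E d)).isBoundedBilinearMap.continuous.comp
    ((continuous_gibbsWeight' hH hu₀ n).prodMk continuous_snd)

variable {K : Set (E d)}

lemma hasFDerivAt_integral_gibbsWeight (hH : Admissible H) (hu₀ : LipschitzWith M u₀)
    (ht : 0 < t) (hK : IsCompact K) (n : ℕ) (x : E d) :
    HasFDerivAt (fun x => ∫ y in K, gibbsWeight H u₀ t n x y)
      (∫ y in K, gibbsWeight' H u₀ t n x y) x :=
  hasFDerivAt_setIntegral_of_isCompact hK (continuous_gibbsWeight hH hu₀ n)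
    (continuous_gibbsWeight' hH hu₀ n) (fun x y => hasFDerivAt_gibbsWeight hH ht n x y) x

lemma hasFDerivAt_integral_gibbsWeight_smul (hH : Admissible H) (hu₀ : LipschitzWith M u₀)
    (ht : 0 < t) (hK : IsCompact K) (n : ℕ) (x : E d) :
    HasFDerivAt (fun x => ∫ y in K, gibbsWeight H u₀ t n x y • y)
      (∫ y in K, (gibbsWeight' H u₀ t n x y).smulRight y) x :=
  hasFDerivAt_setIntegral_of_isCompact hK
    ((continuous_gibbsWeight hH hu₀ n).smul continuous_snd)
    (continuous_gibbsWeight'_smulRight hH hu₀ n)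
    (fun x y => (hasFDerivAt_gibbsWeight hH ht n x y).smul_const y) x

lemma contDiff_integral_gibbsWeight (hH : Admissible H) (hu₀ : LipschitzWith M u₀)
    (ht : 0 < t) (hK : IsCompact K) (n : ℕ) :
    ContDiff ℝ 1 fun x => ∫ y in K, gibbsWeight H u₀ t n x y :=
  contDiff_one_iff_hasFDerivAt.2 ⟨_,
    continuous_parametric_integral_of_continuous (continuous_gibbsWeight' hH hu₀ n) hK,
    hasFDerivAt_integral_gibbsWeight hH hu₀ ht hK n⟩

lemma contDiff_integral_gibbsWeight_smul (hH : Admissible H) (hu₀ : LipschitzWith M u₀)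
    (ht : 0 < t) (hK : IsCompact K) (n : ℕ) :
    ContDiff ℝ 1 fun x => ∫ y in K, gibbsWeight H u₀ t n x y • y :=
  contDiff_one_iff_hasFDerivAt.2 ⟨_,
    continuous_parametric_integral_of_continuous (continuous_gibbsWeight'_smulRight hH hu₀ n) hK,
    hasFDerivAt_integral_gibbsWeight_smul hH hu₀ ht hK n⟩

lemma integrableOn_gibbsWeight (hH : Admissible H) (hu₀ : LipschitzWith M u₀)
    (hK : IsCompact K) (n : ℕ) (x : E d) :
    IntegrableOn (fun y => gibbsWeight H u₀ t n x y) K :=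
  ((continuous_gibbsWeight hH hu₀ n).comp
    (Continuous.prodMk_right x)).continuousOn.integrableOn_compact hK

lemma integral_gibbsWeight_pos (hH : Admissible H) (hu₀ : LipschitzWith M u₀)
    (hK : IsCompact K) (hK0 : volume K ≠ 0) (n : ℕ) (x : E d) :
    0 < ∫ y in K, gibbsWeight H u₀ t n x y := by
  have : NeZero (volume.restrict K) := ⟨fun h => hK0 (by simpa using h)⟩
  exact integral_exp_pos (integrableOn_gibbsWeight hH hu₀ hK n x)

lemma contDiff_gibbsMean (hH : Admissible H) (hu₀ : LipschitzWith M u₀)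
    (ht : 0 < t) (hK : IsCompact K) (hK0 : volume K ≠ 0) (n : ℕ) :
    ContDiff ℝ 1 (gibbsMean H u₀ t K n) :=
  ((contDiff_integral_gibbsWeight hH hu₀ ht hK n).inv
    fun x => (integral_gibbsWeight_pos hH hu₀ hK hK0 n x).ne').smul
    (contDiff_integral_gibbsWeight_smul hH hu₀ ht hK n)

lemma norm_gibbsMean_le (hH : Admissible H) (hu₀ : LipschitzWith M u₀)
    (hK : IsCompact K) (hK0 : volume K ≠ 0) {B : ℝ} (hB : ∀ y ∈ K, ‖y‖ ≤ B) (n : ℕ) (x : E d) :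
    ‖gibbsMean H u₀ t K n x‖ ≤ B := by
  have hZ := integral_gibbsWeight_pos (t := t) hH hu₀ hK hK0 n x
  rw [gibbsMean, norm_smul, norm_inv, Real.norm_eq_abs, abs_of_pos hZ, inv_mul_le_iff₀ hZ,
    ← integral_mul_const]
  refine norm_integral_le_of_norm_le
    ((integrableOn_gibbsWeight hH hu₀ hK n x).mul_const B) ?_
  refine (ae_restrict_iff' hK.measurableSet).2 (Eventually.of_forall fun y hy => ?_)
  rw [norm_smul, Real.norm_eq_abs, gibbsWeight, Real.abs_exp]
  exact mul_le_mul_of_nonneg_left (hB y hy) (Real.exp_pos _).le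

/-- With `P(y) = DL((x - y)/t)`, the quotient rule writes the pairing as `n Z⁻² (⟨C ∫wP, ∫wy⟩ - Z
∫w⟨CP, y⟩)`, minus `n` times a covariance. As `DH(P(a)) - DH(P(b)) = (b - a)/t`, the condition on
`C` says that `C ∘ P` and `y` are oppositely ordered on `K`. -/
lemma pairing_fderiv_gibbsMean_nonneg (hH : Admissible H) (hu₀ : LipschitzWith M u₀)
    (ht : 0 < t) (hK : IsCompact K) (hK0 : volume K ≠ 0) {R : ℝ} {C : E d →L[ℝ] E d}
    (hC : ∀ p q, ‖p‖ ≤ R → ‖q‖ ≤ R → 0 ≤ inner ℝ (C (p - q)) (gradient H p - gradient H q))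
    (n : ℕ) {x : E d} (hx : ∀ y ∈ K, ‖gradient (legendre H) (t⁻¹ • (x - y))‖ ≤ R) :
    0 ≤ pairing C (fderiv ℝ (gibbsMean H u₀ t K n) x) := by
  set w := gibbsWeight H u₀ t n x with hw
  set P : E d → E d := fun y => gradient (legendre H) (t⁻¹ • (x - y)) with hP
  have hZ := integral_gibbsWeight_pos (t := t) hH hu₀ hK hK0 n x
  have hwc : Continuous w := (continuous_gibbsWeight hH hu₀ n).comp (Continuous.prodMk_right x)
  have hPc : Continuous P := (continuous_gradient_legendre hH).comp
    ((continuous_const.sub continuous_id).const_smul t⁻¹)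
  have hd1 := hasFDerivAt_integral_gibbsWeight (u₀ := u₀) hH hu₀ ht hK n x
  have hd2 := hasFDerivAt_integral_gibbsWeight_smul (u₀ := u₀) hH hu₀ ht hK n x
  have hd := ((hasDerivAt_inv hZ.ne').comp_hasFDerivAt x hd1).smul hd2
  have hd' : fderiv ℝ (gibbsMean H u₀ t K n) x = _ := hd.fderiv
  have hcov := integral_mul_integral_inner_le hK hwc (C.continuous.comp hPc) continuous_id
    (fun a => (Real.exp_pos _).le) fun a ha b hb => by
      have h1 := hC _ _ (hx a ha) (hx b hb)
      rw [gradient_gradient_legendre hH, gradient_gradient_legendre hH, ← smul_sub,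
        inner_smul_right, sub_sub_sub_cancel_left] at h1
      have h2 := nonneg_of_mul_nonneg_right h1 (inv_pos.2 ht)
      rw [← neg_sub a b, inner_neg_right] at h2
      simpa only [Function.comp_apply, ← map_sub, id] using neg_nonneg.1 h2
  have h1 : pairing C (∫ y in K, (gibbsWeight' H u₀ t n x y).smulRight y) =
      -n * ∫ y in K, w y * inner ℝ (C (P y)) y := by
    have hi : IntegrableOn (fun y => (gibbsWeight' H u₀ t n x y).smulRight y) K :=
      ((continuous_gibbsWeight'_smulRight hH hu₀ n).comp
        (Continuous.prodMk_right x)).continuousOn.integrableOn_compact hK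
    rw [← ContinuousLinearMap.integral_comp_comm _ hi, ← integral_const_mul]
    refine integral_congr_ae (Eventually.of_forall fun y => ?_)
    simp only [gibbsWeight', pairing_toDual_smulRight, ← hw]
    ring
  have h2 : ∫ y in K, gibbsWeight' H u₀ t n x y =
      (-n : ℝ) • innerSL ℝ (∫ y in K, w y • P y) := by
    have hi : IntegrableOn (fun y => gibbsWeight' H u₀ t n x y) K :=
      ((continuous_gibbsWeight' hH hu₀ n).comp
        (Continuous.prodMk_right x)).continuousOn.integrableOn_compact hK
    ext v
    rw [ContinuousLinearMap.integral_apply hi]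
    simp only [gibbsWeight', smul_apply, innerSL_apply_apply, smul_eq_mul]
    rw [real_inner_comm, ← setIntegral_mul_inner hK hwc hPc, ← integral_const_mul]
    refine integral_congr_ae (Eventually.of_forall fun y => ?_)
    simp only [real_inner_comm v, ← hw, P]
    ring
  have h3 : ∫ y in K, w y • C (P y) = C (∫ y in K, w y • P y) := by
    have hi : IntegrableOn (fun y => w y • P y) K :=
      (hwc.smul hPc).continuousOn.integrableOn_compact hK
    rw [← ContinuousLinearMap.integral_comp_comm _ hi]
    simp only [map_smul]
  rw [hd', map_add, map_smul, h1, h2, smul_smul, pairing_toDual_smulRight]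
  simp only [Function.comp_apply, id, h3, smul_eq_mul] at hcov ⊢
  change _ ≤ inner ℝ _ (∫ y in K, gibbsWeight H u₀ t n x y • y) at hcov
  change (∫ y in K, gibbsWeight H u₀ t n x y) * _ ≤ _ at hcov
  set Z := ∫ y in K, gibbsWeight H u₀ t n x y
  set S := ∫ y in K, w y * inner ℝ (C (P y)) y
  set A := inner ℝ (C (∫ y in K, w y • P y)) (∫ y in K, gibbsWeight H u₀ t n x y • y)
  have h4 : Z⁻¹ * (-n * S) + -(Z ^ 2)⁻¹ * -n * A = n * (Z ^ 2)⁻¹ * (A - Z * S) := by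
    field_simp
    ring
  rw [h4]
  exact mul_nonneg (by positivity) (sub_nonneg.2 hcov)

end Gibbs

/-! ### Monotonicity of the foot map in the distributional sense -/

section LocalMonotonicity

variable {d : ℕ} {H : E d → ℝ} {u₀ : E d → ℝ} {M : ℝ≥0} {t : ℝ} {K : Set (E d)}

/-- Laplace's method: the weight is the `n`-th power of `exp(-cost)`, whose unique maximum is at the
foot because `u(t,·)` is differentiable at `x`. -/
lemma tendsto_gibbsMean (hH : Admissible H) (hu₀ : LipschitzWith M u₀) (ht : 0 < t)
    (hK : IsCompact K) {x : E d} (hx : DifferentiableAt ℝ (hopfLax H u₀ t) x)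
    (hxK : foot H u₀ t x ∈ interior K) :
    Tendsto (fun n => gibbsMean H u₀ t K n x) atTop (𝓝 (foot H u₀ t x)) := by
  have hcost : Continuous (cost H u₀ t x) :=
    (continuous_cost hH hu₀).comp (Continuous.prodMk_right x)
  have h := tendsto_setIntegral_pow_smul_of_unique_maximum_of_isCompact_of_continuousOn
    (μ := volume) (x₀ := foot H u₀ t x) (c := fun y => Real.exp (-cost H u₀ t x y))
    (g := fun y : E d => y) hK (Real.continuous_exp.comp hcost.neg).continuousOn
    (fun y _ hy => Real.exp_lt_exp.2 (neg_lt_neg ?_)) (fun y _ => (Real.exp_pos _).le)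
    (Real.exp_pos _) (subset_closure hxK) continuousOn_id
  · refine h.congr fun n => ?_
    simp only [gibbsMean, gibbsWeight, ← Real.exp_nat_mul, mul_neg]
  · rw [← hopfLax_eq_cost_foot hH hu₀ ht hx]
    refine (hopfLax_le hH hu₀ ht x y).lt_of_ne fun h0 => hy ?_
    exact eq_foot hH hu₀ ht hx h0

/-- The Gibbs averages need a domain that contains the feet of nearby points and on which the
momenta `DL((x - y)/t)` stay below `R`. The gap `R - M` leaves room for both. The radius `r` does
not depend on the centre because only `(x - y)/t` matters. -/
lemma exists_isCompact_foot_mem_interior (hH : Admissible H) (hu₀ : LipschitzWith M u₀)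
    (ht : 0 < t) {R : ℝ} (hR : M < R) :
    ∃ r > 0, ∀ z : E d, ∃ K : Set (E d), IsCompact K ∧ volume K ≠ 0 ∧
      ∀ x ∈ Metric.ball z r, foot H u₀ t x ∈ interior K ∧
        ∀ y ∈ K, ‖gradient (legendre H) (t⁻¹ • (x - y))‖ ≤ R := by
  set P := gradient (legendre H) with hP
  have hPc : Continuous P := continuous_gradient_legendre hH
  set R' := (M + R) / 2 with hR'
  have hδ : 0 < (R - M) / 2 := by linarith
  set S := gradient H '' Metric.closedBall 0 R' with hSdef
  have hS : IsCompact S := (isCompact_closedBall 0 R').image (continuous_gradient hH.contDiff)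
  obtain ⟨ε, hε, hPε⟩ := Metric.mem_uniformity_dist.1
    (hS.uniformContinuousAt_of_continuousAt P (fun a _ => hPc.continuousAt)
      (Metric.dist_mem_uniformity hδ))
  have hnorm : ∀ a ∈ S, ∀ b, ‖a - b‖ < ε → ‖P b‖ < ‖P a‖ + (R - M) / 2 := fun a ha b hab => by
    have h1 : dist (P a) (P b) < (R - M) / 2 := hPε (by rwa [dist_eq_norm]) ha
    rw [dist_eq_norm, norm_sub_rev] at h1
    linarith [norm_sub_norm_le (P b) (P a)]
  have hmem : ∀ a, ‖P a‖ ≤ R' → a ∈ S := fun a ha =>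
    ⟨P a, by simpa using ha, gradient_gradient_legendre hH a⟩
  have hdist : ∀ x z y : E d, x ∈ Metric.ball z (t * ε) →
      ‖t⁻¹ • (x - y) - t⁻¹ • (z - y)‖ < ε := fun x z y hx => by
    rw [← smul_sub, sub_sub_sub_cancel_right, norm_smul, Real.norm_eq_abs,
      abs_of_pos (inv_pos.2 ht), inv_mul_lt_iff₀ ht]
    rwa [mem_ball_iff_norm] at hx
  refine ⟨t * ε, mul_pos ht hε, fun z => ?_⟩
  have hf : Continuous fun y => P (t⁻¹ • (z - y)) :=
    hPc.comp ((continuous_const.sub continuous_id).const_smul t⁻¹)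
  -- Momenta seen from `z` are cut at `R' = (M + R)/2`. Moving from `z` to `x` changes them by less
  -- than `(R - M)/2`, so feet (momentum at most `M` from `x`) fall strictly inside and points of
  -- `K` stay below `R`.
  set K := (fun y => P (t⁻¹ • (z - y))) ⁻¹' Metric.closedBall 0 R'
  have hKc : IsCompact K := by
    refine (hS.image (f := fun q => z - t • q) (by fun_prop)).of_isClosed_subset
      (Metric.isClosed_closedBall.preimage hf) fun y hy => ?_
    refine ⟨t⁻¹ • (z - y), hmem _ (by simpa [K] using hy), ?_⟩
    simp [smul_inv_smul₀ ht.ne']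
  have hfoot : ∀ x ∈ Metric.ball z (t * ε), foot H u₀ t x ∈ interior K := fun x hx => by
    have hsub : (fun y => P (t⁻¹ • (z - y))) ⁻¹' Metric.ball 0 R' ⊆ K :=
      preimage_mono Metric.ball_subset_closedBall
    refine interior_maximal hsub (Metric.isOpen_ball.preimage hf) ?_
    have h1 : ‖P (t⁻¹ • (x - foot H u₀ t x))‖ ≤ M := by
      rw [inv_smul_sub_foot ht, slope, hP, gradient_legendre_gradient hH]
      exact norm_gradient_hopfLax_le hH hu₀ ht x
    have h2 := hnorm _ (hmem _ (h1.trans (by linarith))) _ (hdist x z (foot H u₀ t x) hx)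
    rw [mem_preimage, mem_ball_zero_iff]
    linarith
  refine ⟨K, hKc, ?_, fun x hx => ⟨hfoot x hx, fun y hy => ?_⟩⟩
  · have h1 : foot H u₀ t z ∈ interior K := hfoot z (Metric.mem_ball_self (mul_pos ht hε))
    exact ((isOpen_interior.measure_pos volume ⟨_, h1⟩).trans_le
      (measure_mono interior_subset)).ne'
  · have h1 : ‖P (t⁻¹ • (z - y))‖ ≤ R' := by simpa [K] using hy
    have h2 := hnorm _ (hmem _ h1) (t⁻¹ • (x - y)) (by
      rw [norm_sub_rev]; exact hdist x z y hx)
    linarith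

/-- The weak form of `tr(Cᵀ DF) ≥ 0`, tested on small balls: integrate the Gibbs inequality by parts
against `η`, then let `n → ∞` by dominated convergence. The radius is chosen before `C`, so one
mollification scale later serves all `C`. -/
lemma exists_integral_pairing_foot_nonpos (hH : Admissible H) (hu₀ : LipschitzWith M u₀)
    (ht : 0 < t) {R : ℝ} (hR : M < R) :
    ∃ r > 0, ∀ (C : E d →L[ℝ] E d),
      (∀ p q, ‖p‖ ≤ R → ‖q‖ ≤ R → 0 ≤ inner ℝ (C (p - q)) (gradient H p - gradient H q)) →
      ∀ (z : E d) (η : E d → ℝ), ContDiff ℝ 1 η → (∀ x, 0 ≤ η x) →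
        tsupport η ⊆ Metric.ball z r →
          ∫ x, pairing C ((fderiv ℝ η x).smulRight (foot H u₀ t x)) ≤ 0 := by
  obtain ⟨r, hr, h⟩ := exists_isCompact_foot_mem_interior (u₀ := u₀) hH hu₀ ht hR
  refine ⟨r, hr, fun C hC z η hη hη0 hsupp => ?_⟩
  obtain ⟨K, hK, hK0, hx⟩ := h z
  have hηc : HasCompactSupport η :=
    (isCompact_closedBall z r).of_isClosed_subset (isClosed_tsupport η)
      (hsupp.trans Metric.ball_subset_closedBall)
  have hDη : Continuous (fderiv ℝ η) := hη.continuous_fderiv one_ne_zero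
  obtain ⟨B, hB⟩ := hK.isBounded.exists_norm_le
  have hlim : Tendsto (fun n => ∫ x, pairing C ((fderiv ℝ η x).smulRight
      (gibbsMean H u₀ t K n x))) atTop
      (𝓝 (∫ x, pairing C ((fderiv ℝ η x).smulRight (foot H u₀ t x)))) := by
    refine tendsto_integral_of_dominated_convergence
      (fun x => ‖pairing C‖ * (‖fderiv ℝ η x‖ * B)) (fun n => ?_) ?_ (fun n => ?_) ?_
    · have hg := (contDiff_gibbsMean (u₀ := u₀) hH hu₀ ht hK hK0 n).continuous
      exact ((pairing C).continuous.comp ((ContinuousLinearMap.smulRightL ℝ (E d)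
        (E d)).isBoundedBilinearMap.continuous.comp (hDη.prodMk hg))).aestronglyMeasurable
    · refine ((hDη.norm.integrable_of_hasCompactSupport ?_).mul_const B).const_mul _
      exact (hηc.fderiv ℝ).norm
    · refine Eventually.of_forall fun x => ((pairing C).le_opNorm _).trans ?_
      rw [ContinuousLinearMap.norm_smulRight_apply]
      gcongr
      exact norm_gibbsMean_le hH hu₀ hK hK0 hB n x
    · filter_upwards [ae_differentiableAt_hopfLax (u₀ := u₀) hH hu₀ ht] with x hdx
      by_cases hxz : x ∈ tsupport η
      · have h1 := tendsto_gibbsMean hH hu₀ ht hK hdx (hx x (hsupp hxz)).1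
        exact ((pairing C).continuous.tendsto _).comp
          (((ContinuousLinearMap.smulRightL ℝ (E d) (E d) (fderiv ℝ η x)).continuous.tendsto _).comp
            h1)
      · have h0 : fderiv ℝ η x = 0 :=
          image_eq_zero_of_notMem_tsupport fun h' => hxz (tsupport_fderiv_subset ℝ h')
        simp [h0]
  refine le_of_tendsto' hlim fun n => ?_
  have hibp := integral_mul_pairing_fderiv C hη
    (contDiff_gibbsMean (u₀ := u₀) hH hu₀ ht hK hK0 n) (Or.inl hηc)
  have hpos : 0 ≤ ∫ x, η x * pairing C (fderiv ℝ (gibbsMean H u₀ t K n) x) := by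
    refine integral_nonneg fun x => ?_
    by_cases hxz : x ∈ tsupport η
    · exact mul_nonneg (hη0 x) (pairing_fderiv_gibbsMean_nonneg hH hu₀ ht hK hK0 hC n
        (hx x (hsupp hxz)).2)
    · simp [image_eq_zero_of_notMem_tsupport hxz]
  linarith

end LocalMonotonicity

/-! ### Mollification -/

section Mollification

variable {d : ℕ}

/-- A sequence of bump functions with radii tending to `0`. -/
def bump (d n : ℕ) : ContDiffBump (0 : E d) where
  rIn := (n + 1 : ℝ)⁻¹ / 2
  rOut := (n + 1 : ℝ)⁻¹
  rIn_pos := by positivity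
  rIn_lt_rOut := half_lt_self (by positivity)

/-- The mollification kernels. -/
def kernel (n : ℕ) : E d → ℝ := (bump d n).normed volume

/-- Mollification of a vector field. -/
def mollify (n : ℕ) (F : E d → E d) : E d → E d :=
  convolution (kernel n) F (ContinuousLinearMap.lsmul ℝ ℝ) volume

lemma tendsto_bump_rOut : Tendsto (fun n => (bump d n).rOut) atTop (𝓝 0) := by
  simpa [bump] using tendsto_one_div_add_atTop_nhds_zero_nat (𝕜 := ℝ)

lemma contDiff_kernel (n : ℕ) : ContDiff ℝ 1 (kernel n : E d → ℝ) :=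
  (bump d n).contDiff_normed

lemma kernel_nonneg (n : ℕ) (x : E d) : 0 ≤ kernel n x := (bump d n).nonneg_normed x

lemma hasCompactSupport_kernel (n : ℕ) : HasCompactSupport (kernel n : E d → ℝ) :=
  (bump d n).hasCompactSupport_normed

lemma integral_kernel (n : ℕ) : ∫ x, (kernel n x : ℝ) ∂(volume : Measure (E d)) = 1 :=
  (bump d n).integral_normed

lemma kernel_neg (n : ℕ) (x : E d) : kernel n (-x) = kernel n x :=
  (bump d n).normed_neg x

variable {F : E d → E d}

lemma contDiff_mollify (n : ℕ) (hF : LocallyIntegrable F) : ContDiff ℝ 1 (mollify n F) :=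
  (hasCompactSupport_kernel n).contDiff_convolution_left _ (contDiff_kernel n) hF

lemma tsupport_kernel_sub (n : ℕ) (z : E d) :
    tsupport (fun x => kernel n (z - x)) ⊆ Metric.closedBall z (n + 1 : ℝ)⁻¹ := by
  refine closure_minimal (fun x hx => ?_) Metric.isClosed_closedBall
  have h : z - x ∈ Function.support (kernel n : E d → ℝ) := hx
  rw [kernel, (bump d n).support_normed_eq] at h
  rw [mem_closedBall_iff_norm']
  simpa [bump] using (mem_ball_zero_iff.1 h).le

lemma contDiff_kernel_sub (n : ℕ) (z : E d) : ContDiff ℝ 1 fun x => kernel n (z - x) :=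
  (contDiff_kernel n).comp (contDiff_const.sub contDiff_id)

lemma fderiv_kernel_sub (n : ℕ) (z x : E d) :
    fderiv ℝ (fun x => kernel n (z - x)) x = -fderiv ℝ (kernel n) (z - x) := by
  have h := (((contDiff_kernel n).differentiable one_ne_zero (z - x)).hasFDerivAt).comp x
    ((hasFDerivAt_id x).const_sub z)
  refine HasFDerivAt.fderiv (h.congr_fderiv ?_)
  ext v; simp

/-- The derivative of a mollification is the weak derivative tested against a translated kernel.
Since that kernel has small support, inequalities known only on small balls become pointwise ones
everywhere. -/
lemma pairing_fderiv_mollify (n : ℕ) (hF : LocallyIntegrable F) (C : E d →L[ℝ] E d) (z : E d) :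
    pairing C (fderiv ℝ (mollify n F) z) =
      -∫ x, pairing C ((fderiv ℝ (fun x => kernel n (z - x)) x).smulRight (F x)) := by
  have h := (hasCompactSupport_kernel n).hasFDerivAt_convolution_left
    (ContinuousLinearMap.lsmul ℝ ℝ) (contDiff_kernel n) hF z
  have hi : Integrable fun x => (fderiv ℝ (kernel n) (z - x)).smulRight (F x) := by
    have h1 := ((hasCompactSupport_kernel n).fderiv ℝ).convolutionExists_left
      (ContinuousLinearMap.precompL (E d) (ContinuousLinearMap.lsmul ℝ ℝ (E := E d)))
      ((contDiff_kernel n).continuous_fderiv one_ne_zero) hF z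
    refine (convolutionExistsAt_iff_integrable_swap.1 h1).congr
      (Eventually.of_forall fun x => ?_)
    ext v; simp
  rw [show fderiv ℝ (mollify n F) z = _ from h.fderiv, convolution_eq_swap]
  have h2 : ∀ x, ContinuousLinearMap.precompL (E d) (ContinuousLinearMap.lsmul ℝ ℝ (E := E d))
      (fderiv ℝ (kernel n) (z - x)) (F x) =
      (fderiv ℝ (kernel n) (z - x)).smulRight (F x) := fun x => by
    ext v; simp
  simp_rw [h2, fderiv_kernel_sub]
  rw [← ContinuousLinearMap.integral_comp_comm _ hi, ← integral_neg]
  refine integral_congr_ae (Eventually.of_forall fun x => ?_)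
  have h3 : (-fderiv ℝ (kernel n) (z - x)).smulRight (F x) =
      -(fderiv ℝ (kernel n) (z - x)).smulRight (F x) := by
    ext v; simp
  simp only [h3, map_neg, neg_neg]

lemma norm_mollify_sub_le (n : ℕ) (hF : AEStronglyMeasurable F) {B : ℝ} {z c : E d}
    (hB : ∀ x, ‖F x - x‖ ≤ B) : ‖mollify n F z - c‖ ≤ B + ‖z - c‖ + (n + 1 : ℝ)⁻¹ := by
  rw [← dist_eq_norm]
  have hB0 : 0 ≤ B := (norm_nonneg _).trans (hB 0)
  refine dist_convolution_le (R := (n + 1 : ℝ)⁻¹) (by positivity) ?_ (kernel_nonneg n)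
    (integral_kernel n) hF fun x hx => ?_
  · rw [kernel, (bump d n).support_normed_eq]; rfl
  · rw [mem_ball_iff_norm] at hx
    rw [dist_eq_norm, show F x - c = (F x - x) + ((x - z) + (z - c)) by abel]
    linarith [norm_add_le (F x - x) ((x - z) + (z - c)), norm_add_le (x - z) (z - c), hB x]

lemma locallyIntegrable_of_norm_sub_le (hF : AEStronglyMeasurable F) {B : ℝ}
    (hB : ∀ x, ‖F x - x‖ ≤ B) : LocallyIntegrable F := by
  have h : LocallyIntegrable fun x : E d => B + ‖x‖ :=
    (continuous_const.add continuous_norm).locallyIntegrable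
  refine h.mono hF (Eventually.of_forall fun x => ?_)
  have h1 := norm_add_le (F x - x) x
  rw [sub_add_cancel] at h1
  exact (h1.trans (add_le_add_left (hB x) _)).trans (le_abs_self _)

lemma tendsto_integral_inner_mollify (hF : AEStronglyMeasurable F) {B : ℝ}
    (hB : ∀ x, ‖F x - x‖ ≤ B) {G : E d → E d} (hG : Continuous G) (hGc : HasCompactSupport G) :
    Tendsto (fun n => ∫ x, inner ℝ (G x) (mollify n F x)) atTop (𝓝 (∫ x, inner ℝ (G x) (F x))) := by
  have hFi := locallyIntegrable_of_norm_sub_le hF hB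
  refine tendsto_integral_of_dominated_convergence
    (fun x => ‖G x‖ * (B + ‖x‖ + 1)) (fun n => ?_) ?_ (fun n => ?_) ?_
  · exact (hG.inner (contDiff_mollify n hFi).continuous).aestronglyMeasurable
  · exact (hG.norm.mul (by fun_prop)).integrable_of_hasCompactSupport hGc.norm.mul_right
  · refine Eventually.of_forall fun x => (norm_inner_le_norm _ _).trans ?_
    gcongr
    have h1 := norm_mollify_sub_le n hF (z := x) (c := 0) hB
    have h2 : (n + 1 : ℝ)⁻¹ ≤ 1 := inv_le_one_of_one_le₀ (by simp)
    simp only [sub_zero] at h1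
    linarith
  -- The bound `rOut ≤ 2 * rIn` keeps the kernels comparable to normalized balls, as Lebesgue
  -- differentiation requires.
  · filter_upwards [ContDiffBump.ae_convolution_tendsto_right_of_locallyIntegrable
      (φ := bump d) (K := 2) tendsto_bump_rOut
      (Eventually.of_forall fun n => by simp [bump]; linarith) hFi] with x hx
    exact tendsto_const_nhds.inner hx

end Mollification

/-! ### Pointwise inequalities for the mollified foot map -/

section FootMollification

variable {d : ℕ} {H : E d → ℝ} {u₀ : E d → ℝ} {M : ℝ≥0} {t : ℝ}

lemma exists_norm_foot_sub_le (hH : Admissible H) (hu₀ : LipschitzWith M u₀) (ht : 0 < t) :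
    ∃ B, ∀ x, ‖foot H u₀ t x - x‖ ≤ B := by
  obtain ⟨B, hB⟩ := exists_norm_slope_le (u₀ := u₀) hH hu₀ ht
  refine ⟨t * B, fun x => ?_⟩
  rw [foot, sub_sub_cancel_left, norm_neg, norm_smul, Real.norm_eq_abs, abs_of_pos ht]
  exact mul_le_mul_of_nonneg_left (hB x) ht.le

lemma locallyIntegrable_foot (hH : Admissible H) (hu₀ : LipschitzWith M u₀) (ht : 0 < t) :
    LocallyIntegrable (foot H u₀ t) :=
  let ⟨_, hB⟩ := exists_norm_foot_sub_le (u₀ := u₀) hH hu₀ ht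
  locallyIntegrable_of_norm_sub_le (measurable_foot hH).aestronglyMeasurable hB

lemma eventually_pairing_fderiv_mollify_nonneg (hH : Admissible H) (hu₀ : LipschitzWith M u₀)
    (ht : 0 < t) {R : ℝ} (hR : M < R) :
    ∀ᶠ n in atTop, ∀ C : E d →L[ℝ] E d,
      (∀ p q, ‖p‖ ≤ R → ‖q‖ ≤ R → 0 ≤ inner ℝ (C (p - q)) (gradient H p - gradient H q)) →
      ∀ z, 0 ≤ pairing C (fderiv ℝ (mollify n (foot H u₀ t)) z) := by
  obtain ⟨r, hr, h⟩ := exists_integral_pairing_foot_nonpos (u₀ := u₀) hH hu₀ ht hR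
  filter_upwards [(tendsto_bump_rOut (d := d)).eventually_lt_const hr] with n hn C hC z
  rw [pairing_fderiv_mollify n (locallyIntegrable_foot hH hu₀ ht)]
  exact neg_nonneg.2 (h C hC z _ (contDiff_kernel_sub n z) (fun x => kernel_nonneg n _)
    ((tsupport_kernel_sub n z).trans (Metric.closedBall_subset_ball hn)))

/-- The map `I - λ_R B` meets the monotonicity condition: Cauchy-Schwarz bounds the `B` term by `|p
- q| |DH(p) - DH(q)|`, and `λ_R` is the constant for which `⟨p - q, DH(p) - DH(q)⟩` absorbs it. Thus
the divergence controls the whole derivative. -/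
lemma eventually_mul_pairing_fderiv_mollify_le (hH : Admissible H) (hu₀ : LipschitzWith M u₀)
    (ht : 0 < t) {R : ℝ} (hR : M < R) :
    ∀ᶠ n in atTop, ∀ B : E d →L[ℝ] E d, ‖B‖ ≤ 1 → ∀ z,
      (dirConvexityConst H R).toReal * pairing B (fderiv ℝ (mollify n (foot H u₀ t)) z) ≤
        pairing (ContinuousLinearMap.id ℝ (E d)) (fderiv ℝ (mollify n (foot H u₀ t)) z) := by
  filter_upwards [eventually_pairing_fderiv_mollify_nonneg (u₀ := u₀) hH hu₀ ht hR]
    with n hn B hB z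
  set c := (dirConvexityConst H R).toReal
  have hc : 0 ≤ c := ENNReal.toReal_nonneg
  have h := hn (ContinuousLinearMap.id ℝ (E d) + (-c) • B) (fun p q hp hq => ?_) z
  · rw [pairing_add, pairing_smul] at h
    linarith
  · have h1 := inner_gradient_sub_ge hH hp hq
    have h2 : inner ℝ (B (p - q)) (gradient H p - gradient H q) ≤
        ‖gradient H p - gradient H q‖ * ‖p - q‖ := by
      rw [mul_comm]
      refine (real_inner_le_norm _ _).trans (mul_le_mul_of_nonneg_right ?_ (norm_nonneg _))
      exact (B.le_opNorm _).trans (mul_le_of_le_one_left (norm_nonneg _) hB)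
    have h3 := mul_le_mul_of_nonneg_left h2 hc
    simp only [add_apply, smul_apply, ContinuousLinearMap.id_apply, inner_add_left,
      real_inner_smul_left]
    rw [real_inner_comm] at h1
    linarith

end FootMollification

/-! ### The perimeter is at most the Hausdorff measure of the boundary -/

section Tubes

/-- The union of the segments `[a, a + h ν]` with `a ∈ B`. -/
def tube {d : ℕ} (h : ℝ) (ν : E d) (B : Set (E d)) : Set (E d) :=
  (fun z : E d × ℝ => z.1 + z.2 • ν) '' (B ×ˢ Icc 0 h)

lemma euclideanHausdorffMeasure_image_le {X Y : Type*} [MetricSpace X]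
    [MeasurableSpace X] [BorelSpace X] [MetricSpace Y] [MeasurableSpace Y] [BorelSpace Y]
    {f : X → Y} (hf : LipschitzWith 1 f) (n : ℕ) (s : Set X) :
    Measure.euclideanHausdorffMeasure n (f '' s) ≤ Measure.euclideanHausdorffMeasure n s := by
  simp_rw [Measure.euclideanHausdorffMeasure_def, Measure.smul_apply]
  gcongr
  simpa using hf.hausdorffMeasure_image_le (Nat.cast_nonneg n) s

/-- The tube lies in an interval of length `δ + h` times the projection of `B`, and projecting is
1-Lipschitz, so it does not increase Hausdorff measure. -/
lemma volume_tube_single_le {n : ℕ} {h δ a : ℝ} {B : Set (E (n + 1))}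
    (hB : ∀ x ∈ B, x 0 ∈ Icc a (a + δ)) :
    volume (tube h (EuclideanSpace.single 0 1) B) ≤
      ENNReal.ofReal (δ + h) * Measure.euclideanHausdorffMeasure n B := by
  set tail : E (n + 1) → E n := fun x => WithLp.toLp 2 fun i => x i.succ with htail
  have hlip : LipschitzWith 1 tail := by
    refine LipschitzWith.of_dist_le_mul fun x y => ?_
    rw [NNReal.coe_one, one_mul, EuclideanSpace.dist_eq, EuclideanSpace.dist_eq]
    refine Real.sqrt_le_sqrt ?_
    rw [Fin.sum_univ_succ (n := n)]
    exact le_add_of_nonneg_left (sq_nonneg _)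
  have hp : MeasurePreserving
      (fun x : E (n + 1) => MeasurableEquiv.piFinSuccAbove (fun _ => ℝ) 0 (WithLp.ofLp x)) :=
    (volume_preserving_piFinSuccAbove (fun _ : Fin (n + 1) => ℝ) 0).comp
      (PiLp.volume_preserving_ofLp (Fin (n + 1)))
  have hemb : MeasurableEmbedding
      (fun x : E (n + 1) => MeasurableEquiv.piFinSuccAbove (fun _ => ℝ) 0 (WithLp.ofLp x)) :=
    (MeasurableEquiv.measurableEmbedding _).comp
      (MeasurableEquiv.toLp 2 (Fin (n + 1) → ℝ)).symm.measurableEmbedding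
  have hsub : tube h (EuclideanSpace.single 0 1) B ⊆
      (fun x : E (n + 1) => MeasurableEquiv.piFinSuccAbove (fun _ => ℝ) 0 (WithLp.ofLp x)) ⁻¹'
        (Icc a (a + (δ + h)) ×ˢ (WithLp.toLp 2 ⁻¹' (tail '' B))) := by
    rintro _ ⟨⟨b, s⟩, ⟨hb, hs⟩, rfl⟩
    have hb0 := hB b hb
    refine ⟨?_, b, hb, ?_⟩
    · simp only [MeasurableEquiv.piFinSuccAbove_apply, mem_Icc] at hb0 hs ⊢
      simp
      constructor <;> linarith
    · simp only [htail]
      congr 1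
      ext i
      simp [MeasurableEquiv.piFinSuccAbove_apply, Fin.tail]
  refine (measure_mono hsub).trans ?_
  rw [hp.measure_preimage_emb hemb]
  change (volume.prod volume) _ ≤ _
  rw [Measure.prod_prod, Real.volume_Icc, add_sub_cancel_left]
  gcongr
  rw [(PiLp.volume_preserving_toLp (Fin n)).measure_preimage_emb
    (MeasurableEquiv.toLp 2 (Fin n → ℝ)).measurableEmbedding,
    ← EuclideanSpace.euclideanHausdorffMeasure_eq_volume]
  exact euclideanHausdorffMeasure_image_le hlip n B

lemma exists_linearIsometryEquiv_single {n : ℕ} {ν : E (n + 1)} (hν : ‖ν‖ = 1) :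
    ∃ Φ : E (n + 1) ≃ₗᵢ[ℝ] E (n + 1), Φ ν = EuclideanSpace.single 0 1 := by
  have ho : Orthonormal ℝ (({0} : Set (Fin (n + 1))).domRestrict fun _ => ν) := by
    refine ⟨fun _ => hν, fun i j hij => ?_⟩
    exact absurd (Subsingleton.elim i j) hij
  obtain ⟨b, hb⟩ := ho.exists_orthonormalBasis_extension_of_card_eq (by simp)
  refine ⟨b.repr, ?_⟩
  rw [← hb 0 rfl, b.repr_self]

lemma volume_tube_le {d : ℕ} (hd : 0 < d) {h δ : ℝ} {ν : E d} (hν : ‖ν‖ = 1) {B : Set (E d)}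
    (hB : ∀ x ∈ B, ∀ y ∈ B, dist x y ≤ δ) :
    volume (tube h ν B) ≤
      ENNReal.ofReal (2 * δ + h) * Measure.euclideanHausdorffMeasure (d - 1) B := by
  obtain ⟨n, rfl⟩ : ∃ n, d = n + 1 := ⟨d - 1, by omega⟩
  rw [Nat.add_sub_cancel]
  rcases B.eq_empty_or_nonempty with rfl | ⟨b, hb⟩
  · simp [tube]
  obtain ⟨Φ, hΦ⟩ := exists_linearIsometryEquiv_single hν
  have himg : Φ '' tube h ν B = tube h (EuclideanSpace.single 0 1) (Φ '' B) := by
    rw [tube, tube, image_image]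
    ext x
    constructor
    · rintro ⟨⟨a, s⟩, ⟨ha, hs⟩, rfl⟩
      exact ⟨(Φ a, s), ⟨mem_image_of_mem _ ha, hs⟩, by simp [hΦ]⟩
    · rintro ⟨⟨_, s⟩, ⟨⟨a, ha, rfl⟩, hs⟩, rfl⟩
      exact ⟨(a, s), ⟨ha, hs⟩, by simp [hΦ]⟩
  -- Rotate `ν` to the first basis vector, reading volume as top-dimensional Hausdorff measure so
  -- that isometry invariance applies to arbitrary sets.
  rw [← Φ.isometry.euclideanHausdorffMeasure_image B,
    ← EuclideanSpace.euclideanHausdorffMeasure_eq_volume,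
    ← Φ.isometry.euclideanHausdorffMeasure_image, himg,
    EuclideanSpace.euclideanHausdorffMeasure_eq_volume]
  -- The slab of thickness `2δ` is centred at an arbitrary point of `B`.
  refine volume_tube_single_le (a := Φ b 0 - δ) ?_
  rintro _ ⟨x, hx, rfl⟩
  have h1 : |(Φ x - Φ b) 0| ≤ δ := by
    refine (PiLp.norm_apply_le (Φ x - Φ b) 0).trans ?_
    rw [← map_sub, Φ.norm_map, ← dist_eq_norm]
    exact hB x hx b hb
  rw [PiLp.sub_apply] at h1
  have h2 := abs_le.1 h1
  exact ⟨by linarith [h2.1], by linarith [h2.2]⟩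

lemma isCompact_tube {d : ℕ} {h : ℝ} {ν : E d} {B : Set (E d)} (hB : IsCompact B) :
    IsCompact (tube h ν B) :=
  (hB.prod isCompact_Icc).image (by fun_prop)

/-- Cut `A` into countably many disjoint pieces of diameter at most `δ`. On the tube over a piece,
`ψ` differs from its values on the piece by at most `l(δ + h)`, and `volume_tube_le` bounds the
volume of that tube. -/
lemma setLIntegral_tube_le {d : ℕ} (hd : 0 < d) {h δ : ℝ} (hδ : 0 < δ)
    {ν : E d} (hν : ‖ν‖ = 1) {A : Set (E d)} (hA : MeasurableSet A) {ψ : E d → ℝ} {l : ℝ≥0}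
    (hψ : LipschitzWith l ψ) :
    ∫⁻ x in tube h ν A, ‖ψ x‖ₑ ≤ ENNReal.ofReal (2 * δ + h) *
      ∫⁻ a in A, (‖ψ a‖ₑ + ENNReal.ofReal (l * (δ + h)))
        ∂Measure.euclideanHausdorffMeasure (d - 1) := by
  set c := ENNReal.ofReal (l * (δ + h))
  set U : ℕ → Set (E d) := disjointed fun k =>
    Metric.closedBall (TopologicalSpace.denseSeq (E d) k) (δ / 2)
  have hUm : ∀ k, MeasurableSet (U k) :=
    MeasurableSet.disjointed fun k => Metric.isClosed_closedBall.measurableSet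
  have hUd : ∀ k, ∀ x ∈ U k, ∀ y ∈ U k, dist x y ≤ δ := fun k x hx y hy => by
    have h1 := Metric.mem_closedBall.1 (disjointed_subset _ k hx)
    have h2 := Metric.mem_closedBall'.1 (disjointed_subset _ k hy)
    linarith [dist_triangle x (TopologicalSpace.denseSeq (E d) k) y]
  have hUu : ⋃ k, U k = univ := by
    rw [iUnion_disjointed, eq_univ_iff_forall]
    intro x
    obtain ⟨k, hk⟩ := (TopologicalSpace.denseRange_denseSeq (E d)).exists_dist_lt x (half_pos hδ)
    exact mem_iUnion.2 ⟨k, hk.le⟩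
  have hAu : A = ⋃ k, A ∩ U k := by rw [← inter_iUnion, hUu, inter_univ]
  have htube : tube h ν A ⊆ ⋃ k, tube h ν (A ∩ U k) := by
    rintro _ ⟨⟨a, s⟩, ⟨ha, hs⟩, rfl⟩
    rw [hAu] at ha
    obtain ⟨k, hk⟩ := mem_iUnion.1 ha
    exact mem_iUnion.2 ⟨k, (a, s), ⟨hk, hs⟩, rfl⟩
  have hpiece : ∀ k, ∫⁻ x in tube h ν (A ∩ U k), ‖ψ x‖ₑ ≤ ENNReal.ofReal (2 * δ + h) *
      ∫⁻ a in A ∩ U k, (‖ψ a‖ₑ + c) ∂Measure.euclideanHausdorffMeasure (d - 1) := fun k => by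
    set m := ⨅ a ∈ A ∩ U k, (‖ψ a‖ₑ + c)
    have h1 : ∀ x ∈ tube h ν (A ∩ U k), ‖ψ x‖ₑ ≤ m := by
      rintro _ ⟨⟨b, s⟩, ⟨hb, hs⟩, rfl⟩
      refine le_iInf₂ fun a ha => ?_
      have h2 : |ψ (b + s • ν) - ψ a| ≤ l * (δ + h) := by
        rw [← Real.dist_eq]
        refine (hψ.dist_le_mul _ _).trans (mul_le_mul_of_nonneg_left ?_ l.2)
        have h3 : dist (b + s • ν) b ≤ h := by
          rw [dist_eq_norm, add_sub_cancel_left, norm_smul, hν, mul_one, Real.norm_eq_abs,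
            abs_of_nonneg hs.1]
          exact hs.2
        linarith [dist_triangle (b + s • ν) b a, hUd k b hb.2 a ha.2]
      rw [Real.enorm_eq_ofReal_abs, Real.enorm_eq_ofReal_abs,
        ← ENNReal.ofReal_add (abs_nonneg _) ((abs_nonneg _).trans h2)]
      refine ENNReal.ofReal_le_ofReal ?_
      linarith [abs_sub_abs_le_abs_sub (ψ (b + s • ν)) (ψ a)]
    calc ∫⁻ x in tube h ν (A ∩ U k), ‖ψ x‖ₑ
        ≤ ∫⁻ _ in tube h ν (A ∩ U k), m := setLIntegral_mono measurable_const h1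
      _ = m * volume (tube h ν (A ∩ U k)) := setLIntegral_const _ _
      _ ≤ m * (ENNReal.ofReal (2 * δ + h) *
          Measure.euclideanHausdorffMeasure (d - 1) (A ∩ U k)) := by
        gcongr
        exact volume_tube_le hd hν fun x hx y hy => hUd k x hx.2 y hy.2
      _ = ENNReal.ofReal (2 * δ + h) *
          ∫⁻ _ in A ∩ U k, m ∂Measure.euclideanHausdorffMeasure (d - 1) := by
        rw [setLIntegral_const]; ring
      _ ≤ _ := by
        refine mul_le_mul_right (setLIntegral_mono ?_ fun a ha =>
          (iInf₂_le a ha : m ≤ ‖ψ a‖ₑ + c)) _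
        exact (hψ.continuous.enorm.measurable).add_const c
  calc ∫⁻ x in tube h ν A, ‖ψ x‖ₑ ≤ ∫⁻ x in ⋃ k, tube h ν (A ∩ U k), ‖ψ x‖ₑ :=
        lintegral_mono_set htube
    _ ≤ ∑' k, ∫⁻ x in tube h ν (A ∩ U k), ‖ψ x‖ₑ := lintegral_iUnion_le _ _
    _ ≤ ∑' k, ENNReal.ofReal (2 * δ + h) *
      ∫⁻ a in A ∩ U k, (‖ψ a‖ₑ + c) ∂Measure.euclideanHausdorffMeasure (d - 1) :=
        ENNReal.tsum_le_tsum hpiece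
    _ = _ := by
      rw [ENNReal.tsum_mul_left, ← lintegral_iUnion (fun k => hA.inter (hUm k))
        (fun i j hij => (disjoint_disjointed _ hij).mono inter_subset_right inter_subset_right),
        ← hAu]

end Tubes

/-! ### Directional derivatives integrated over an open set -/

section Boundary

variable {d : ℕ} {Ω : Set (E d)}

/-- A segment with one end in `Ω` and the other outside meets the frontier, by connectedness. Hence
`Ω` and its translate differ only inside the tube over the frontier. -/
lemma mem_tube_frontier (hΩ : IsOpen Ω) {h : ℝ} (hh : 0 ≤ h) {ν x : E d}
    (hx : ¬(x ∈ Ω ↔ x - h • ν ∈ Ω)) : x ∈ tube h ν (frontier Ω) := by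
  by_contra hnot
  set s := (fun s : ℝ => x - s • ν) '' Icc 0 h
  have hs : IsPreconnected s := isPreconnected_Icc.image _ (by fun_prop)
  have h0 : x ∈ s := ⟨0, left_mem_Icc.2 hh, by simp⟩
  have h1 : x - h • ν ∈ s := ⟨h, right_mem_Icc.2 hh, rfl⟩
  have hcl : closure Ω ∩ s ⊆ Ω := by
    rintro _ ⟨hc, r, hr, rfl⟩
    by_contra hout
    refine hnot ⟨(x - r • ν, r), ⟨?_, hr⟩, by simp⟩
    rw [hΩ.frontier_eq]
    exact ⟨hc, hout⟩
  refine hx ⟨fun hm => ?_, fun hm => ?_⟩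
  · exact hs.subset_of_closure_inter_subset hΩ ⟨x, h0, hm⟩ hcl h1
  · exact hs.subset_of_closure_inter_subset hΩ ⟨_, h1, hm⟩ hcl h0

lemma abs_setIntegral_translate_sub_le (hΩ : IsOpen Ω) (hb : Bornology.IsBounded Ω) {h : ℝ}
    (hh : 0 ≤ h) {ν : E d} {ψ : E d → ℝ} (hψ : Continuous ψ) :
    |(∫ x in Ω, ψ (x + h • ν)) - ∫ x in Ω, ψ x| ≤ ∫ x in tube h ν (frontier Ω), |ψ x| := by
  have hA : IsCompact (tube h ν (frontier Ω)) := isCompact_tube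
    (hb.isCompact_closure.of_isClosed_subset isClosed_frontier frontier_subset_closure)
  set T : Set (E d) := {x | x - h • ν ∈ Ω}
  have hT : ∀ x, x ∈ T ↔ x - h • ν ∈ Ω := fun _ => Iff.rfl
  have hi1 : Integrable (Ω.indicator ψ) :=
    ((hψ.continuousOn.integrableOn_compact hb.isCompact_closure).mono_set
      subset_closure).integrable_indicator hΩ.measurableSet
  have hi3 : Integrable (Ω.indicator fun x => ψ (x + h • ν)) :=
    (((hψ.comp (continuous_add_const (h • ν))).continuousOn.integrableOn_compact
      hb.isCompact_closure).mono_set subset_closure).integrable_indicator hΩ.measurableSet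
  have h1 : ∀ x, Ω.indicator (fun x => ψ (x + h • ν)) (x - h • ν) = T.indicator ψ x := fun x => by
    by_cases hx : x ∈ T
    · rw [indicator_of_mem hx, indicator_of_mem ((hT x).1 hx), sub_add_cancel]
    · rw [indicator_of_notMem hx, indicator_of_notMem fun h0 => hx ((hT x).2 h0)]
  have h2 : ∫ x in Ω, ψ (x + h • ν) = ∫ x, T.indicator ψ x := by
    rw [← integral_indicator hΩ.measurableSet, ← integral_sub_right_eq_self _ (h • ν)]
    simp_rw [h1]
  have hi2 : Integrable (T.indicator ψ) :=
    (hi3.comp_sub_right (h • ν)).congr (Eventually.of_forall h1)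
  rw [h2, ← integral_indicator hΩ.measurableSet, ← integral_sub hi2 hi1, ← Real.norm_eq_abs,
    ← integral_indicator hA.measurableSet]
  refine norm_integral_le_of_norm_le ?_ (Eventually.of_forall fun x => ?_)
  · exact (hψ.abs.continuousOn.integrableOn_compact hA).integrable_indicator hA.measurableSet
  · by_cases hx : x ∈ Ω ↔ x - h • ν ∈ Ω
    · have h3 : T.indicator ψ x = Ω.indicator ψ x := by
        by_cases h4 : x ∈ Ω
        · rw [indicator_of_mem h4, indicator_of_mem ((hT x).2 (hx.1 h4))]
        · rw [indicator_of_notMem h4,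
            indicator_of_notMem fun h5 => h4 (hx.2 ((hT x).1 h5))]
      rw [h3, sub_self, norm_zero]
      exact indicator_nonneg (fun _ _ => abs_nonneg _) x
    · rw [indicator_of_mem (mem_tube_frontier hΩ hh hx)]
      by_cases h4 : x ∈ Ω
      · have h5 : x ∉ T := fun h5 => hx ⟨fun _ => h5, fun _ => h4⟩
        rw [indicator_of_mem h4, indicator_of_notMem h5, zero_sub, norm_neg, Real.norm_eq_abs]
      · have h5 : x ∈ T := by
          by_contra h5
          exact hx ⟨fun h => absurd h h4, fun h => absurd h h5⟩
        rw [indicator_of_notMem h4, indicator_of_mem h5, sub_zero, Real.norm_eq_abs]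

lemma setIntegral_tube_le (hd : 0 < d) {h : ℝ} (hh : 0 < h) {ν : E d} (hν : ‖ν‖ = 1)
    {A : Set (E d)} (hA : IsCompact A)
    (hA' : Measure.euclideanHausdorffMeasure (d - 1) A ≠ ∞) {ψ : E d → ℝ} {l : ℝ≥0}
    (hψ : LipschitzWith l ψ) :
    h⁻¹ * ∫ x in tube h ν A, |ψ x| ≤ (2 * h + 1) *
      ((∫ a in A, |ψ a| ∂Measure.euclideanHausdorffMeasure (d - 1)) +
        l * (h ^ 2 + h) * (Measure.euclideanHausdorffMeasure (d - 1)).real A) := by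
  set μ : Measure (E d) := Measure.euclideanHausdorffMeasure (d - 1)
  have : IsFiniteMeasure (μ.restrict A) := ⟨by simpa using hA'.lt_top⟩
  have hI : IntegrableOn (fun a => |ψ a|) A μ :=
    hψ.continuous.abs.continuousOn.integrableOn_of_subset_isCompact hA hA.measurableSet
      subset_rfl hA'
  -- Pieces of size `h²` make `(2δ + h)/h = 2h + 1` tend to `1`, so no constant is lost as `h → 0`.
  have h1 := setLIntegral_tube_le hd (h := h) (δ := h ^ 2) (by positivity) hν hA.measurableSet hψ
  have h2 : ∫⁻ a in A, (‖ψ a‖ₑ + ENNReal.ofReal (l * (h ^ 2 + h))) ∂μ =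
      ENNReal.ofReal ((∫ a in A, |ψ a| ∂μ) + l * (h ^ 2 + h) * μ.real A) := by
    rw [lintegral_add_right _ measurable_const, setLIntegral_const,
      ENNReal.ofReal_add (integral_nonneg fun _ => abs_nonneg _) (by positivity),
      ENNReal.ofReal_mul (p := l * (h ^ 2 + h)) (by positivity), ofReal_measureReal hA',
      ofReal_integral_eq_lintegral_ofReal hI (Eventually.of_forall fun _ => abs_nonneg _)]
    simp_rw [Real.enorm_eq_ofReal_abs]
  have h3 : ∫⁻ x in tube h ν A, ‖ψ x‖ₑ = ENNReal.ofReal (∫ x in tube h ν A, |ψ x|) := by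
    rw [ofReal_integral_eq_lintegral_ofReal
      (hψ.continuous.abs.continuousOn.integrableOn_compact (isCompact_tube hA))
      (Eventually.of_forall fun _ => abs_nonneg _)]
    simp_rw [Real.enorm_eq_ofReal_abs]
  rw [h2, h3, ← ENNReal.ofReal_mul (by positivity), ENNReal.ofReal_le_ofReal_iff
    (mul_nonneg (by positivity) (add_nonneg (integral_nonneg fun _ => abs_nonneg _)
      (by positivity)))] at h1
  rw [inv_mul_le_iff₀ hh]
  refine h1.trans_eq ?_
  ring

/-- The derivative is the limit of difference quotients, and each quotient integrates to at most
`h⁻¹` times the integral of `|ψ|` over a tube of height `h` around the frontier. -/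
lemma abs_setIntegral_fderiv_le (hd : 0 < d) (hΩ : IsOpen Ω) (hb : Bornology.IsBounded Ω)
    (hA : Measure.euclideanHausdorffMeasure (d - 1) (frontier Ω) ≠ ∞) {ψ : E d → ℝ}
    (hψ : ContDiff ℝ 1 ψ) (hψc : HasCompactSupport ψ) {ν : E d} (hν : ‖ν‖ = 1) :
    |∫ x in Ω, fderiv ℝ ψ x ν| ≤
      ∫ a in frontier Ω, |ψ a| ∂Measure.euclideanHausdorffMeasure (d - 1) := by
  obtain ⟨l, hl⟩ := hψ.lipschitzWith_of_hasCompactSupport hψc one_ne_zero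
  have hAc : IsCompact (frontier Ω) :=
    hb.isCompact_closure.of_isClosed_subset isClosed_frontier frontier_subset_closure
  have hfin : volume Ω ≠ ∞ := hb.measure_lt_top.ne
  have hint : ∀ {f : E d → ℝ}, Continuous f → IntegrableOn f Ω := fun hf =>
    (hf.continuousOn.integrableOn_compact hb.isCompact_closure).mono_set subset_closure
  have hlim : Tendsto (fun h : ℝ => ∫ x in Ω, h⁻¹ * (ψ (x + h • ν) - ψ x)) (𝓝[>] 0)
      (𝓝 (∫ x in Ω, fderiv ℝ ψ x ν)) := by
    refine tendsto_integral_filter_of_dominated_convergence (fun _ => (l : ℝ)) ?_ ?_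
      (integrableOn_const hfin) ?_
    · refine Eventually.of_forall fun h => Continuous.aestronglyMeasurable ?_
      have := hψ.continuous
      fun_prop
    · filter_upwards [self_mem_nhdsWithin] with h (hh : 0 < h)
      refine Eventually.of_forall fun x => ?_
      have h1 := hl.dist_le_mul (x + h • ν) x
      rw [Real.dist_eq, dist_eq_norm, add_sub_cancel_left, norm_smul, hν, mul_one,
        Real.norm_eq_abs, abs_of_pos hh] at h1
      rw [norm_mul, norm_inv, Real.norm_eq_abs, Real.norm_eq_abs, abs_of_pos hh,
        inv_mul_le_iff₀ hh, mul_comm]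
      exact h1
    · refine Eventually.of_forall fun x => ?_
      have h1 : HasLineDerivAt ℝ ψ (fderiv ℝ ψ x ν) x ν :=
        ((hψ.differentiable one_ne_zero) x).hasFDerivAt.hasLineDerivAt ν
      exact h1.tendsto_slope_zero_right
  have hlim2 : Tendsto (fun h : ℝ => (2 * h + 1) *
      ((∫ a in frontier Ω, |ψ a| ∂Measure.euclideanHausdorffMeasure (d - 1)) +
        l * (h ^ 2 + h) * (Measure.euclideanHausdorffMeasure (d - 1)).real (frontier Ω)))
      (𝓝[>] 0) (𝓝 (∫ a in frontier Ω, |ψ a| ∂Measure.euclideanHausdorffMeasure (d - 1))) := by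
    refine (Continuous.tendsto' ?_ 0 _ ?_).mono_left nhdsWithin_le_nhds
    · fun_prop
    · simp
  refine le_of_tendsto_of_tendsto hlim.abs hlim2 ?_
  filter_upwards [self_mem_nhdsWithin] with h (hh : 0 < h)
  refine le_trans ?_ (setIntegral_tube_le hd hh hν hAc hA hl)
  have h1 := abs_setIntegral_translate_sub_le hΩ hb hh.le (ν := ν) hψ.continuous
  have hc : Continuous fun x => ψ (x + h • ν) := by
    have := hψ.continuous
    fun_prop
  rw [integral_const_mul, integral_sub (hint hc) (hint hψ.continuous), abs_mul, abs_inv,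
    abs_of_pos hh]
  exact mul_le_mul_of_nonneg_left h1 (inv_nonneg.2 hh.le)

end Boundary

/-! ### From directional derivatives to the divergence of a vector field -/

section DivergenceBound

variable {d : ℕ} {Ω : Set (E d)}

lemma hasCompactSupport_kernel_sub (n : ℕ) (z : E d) :
    HasCompactSupport fun x => kernel n (z - x) :=
  (isCompact_closedBall z _).of_isClosed_subset (isClosed_tsupport _) (tsupport_kernel_sub n z)

lemma kernel_sub_comm (n : ℕ) (x z : E d) : kernel n (x - z) = kernel n (z - x) := by
  rw [← neg_sub, kernel_neg]

lemma integral_kernel_sub (n : ℕ) (x : E d) : ∫ z, kernel n (x - z) = 1 := by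
  rw [integral_sub_left_eq_self (kernel n) volume x, integral_kernel]

lemma divergence_mollify (n : ℕ) {φ : E d → E d} (hφ : ContDiff ℝ 1 φ) (x : E d) :
    divergence (mollify n φ) x = ∫ z, kernel n (x - z) * divergence φ z := by
  simp_rw [divergence_eq_pairing]
  rw [pairing_fderiv_mollify n hφ.continuous.locallyIntegrable,
    ← integral_mul_pairing_fderiv _ (contDiff_kernel_sub n x) hφ
      (Or.inl (hasCompactSupport_kernel_sub n x))]

lemma pairing_id_smulRight (l : E d →L[ℝ] ℝ) (a : E d) :
    pairing (ContinuousLinearMap.id ℝ (E d)) (l.smulRight a) = l a := by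
  rw [pairing_smulRight, ContinuousLinearMap.id_apply, InnerProductSpace.toDual_symm_apply]

/-- Writes the divergence as a superposition over `z` of derivatives of scalar kernels, each in the
single direction `φ z`, which is fixed as `x` varies. -/
lemma divergence_mollify_eq_integral_fderiv (n : ℕ) {φ : E d → E d} (hφ : ContDiff ℝ 1 φ)
    (x : E d) : divergence (mollify n φ) x =
      ∫ z, fderiv ℝ (fun y => kernel n (z - y)) x (φ z) := by
  rw [divergence_eq_pairing, pairing_fderiv_mollify n hφ.continuous.locallyIntegrable,
    ← integral_neg]
  refine integral_congr_ae (Eventually.of_forall fun z => ?_)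
  simp only [pairing_id_smulRight, fderiv_kernel_sub]
  have h : ∀ y : E d, fderiv ℝ (kernel n) (-y) = -fderiv ℝ (kernel n) y := fun y => by
    have h1 : HasFDerivAt (fun y : E d => kernel n (-y))
        ((fderiv ℝ (kernel n) (-y)).comp (-ContinuousLinearMap.id ℝ (E d))) y :=
      ((contDiff_kernel n).differentiable one_ne_zero (-y)).hasFDerivAt.comp y
        (hasFDerivAt_id y).neg
    simp_rw [kernel_neg] at h1
    rw [h1.fderiv]
    ext v; simp
  rw [← neg_sub x z, h]
  simp

lemma continuous_divergence {φ : E d → E d} (hφ : ContDiff ℝ 1 φ) :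
    Continuous (divergence φ) := by
  rw [funext (divergence_eq_pairing φ)]
  exact (pairing _).continuous.comp (hφ.continuous_fderiv one_ne_zero)

lemma hasCompactSupport_divergence {φ : E d → E d} (hc : HasCompactSupport φ) :
    HasCompactSupport (divergence φ) := by
  rw [funext (divergence_eq_pairing φ)]
  exact (hc.fderiv ℝ).comp_left (map_zero (pairing _))

lemma tendsto_setIntegral_divergence_mollify (hb : Bornology.IsBounded Ω) {φ : E d → E d}
    (hφ : ContDiff ℝ 1 φ) (hc : HasCompactSupport φ) :
    Tendsto (fun n => ∫ x in Ω, divergence (mollify n φ) x) atTop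
      (𝓝 (∫ x in Ω, divergence φ x)) := by
  have hcont := continuous_divergence hφ
  obtain ⟨B, hB⟩ := (hasCompactSupport_divergence hc).exists_bound_of_continuous hcont
  have hker : ∀ (n : ℕ) (x : E d), Integrable fun z => kernel n (x - z) := fun n x =>
    (contDiff_kernel_sub n x).continuous.integrable_of_hasCompactSupport
      (hasCompactSupport_kernel_sub n x)
  refine tendsto_integral_of_dominated_convergence (fun _ => B) (fun n => ?_)
    (integrableOn_const hb.measure_lt_top.ne) (fun n => Eventually.of_forall fun x => ?_)
    (Eventually.of_forall fun x => ?_)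
  · exact (continuous_divergence
      (contDiff_mollify n hφ.continuous.locallyIntegrable)).aestronglyMeasurable
  · rw [divergence_mollify n hφ]
    have h1 := norm_integral_le_of_norm_le ((hker n x).mul_const B)
      (f := fun z => kernel n (x - z) * divergence φ z) (Eventually.of_forall fun z => by
        rw [norm_mul, Real.norm_of_nonneg (kernel_nonneg n _)]
        exact mul_le_mul_of_nonneg_left (hB z) (kernel_nonneg n _))
    rwa [integral_mul_const, integral_kernel_sub, one_mul] at h1
  · have h1 := ContDiffBump.convolution_tendsto_right_of_continuous (μ := volume)
      (φ := bump d) tendsto_bump_rOut hcont x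
    refine h1.congr fun n => ?_
    rw [divergence_mollify n hφ, convolution_eq_swap]
    rfl

lemma abs_setIntegral_fderiv_apply_le (hd : 0 < d) (hΩ : IsOpen Ω) (hb : Bornology.IsBounded Ω)
    (hA : Measure.euclideanHausdorffMeasure (d - 1) (frontier Ω) ≠ ∞) {ψ : E d → ℝ}
    (hψ : ContDiff ℝ 1 ψ) (hψc : HasCompactSupport ψ) (v : E d) :
    |∫ x in Ω, fderiv ℝ ψ x v| ≤
      ‖v‖ * ∫ a in frontier Ω, |ψ a| ∂Measure.euclideanHausdorffMeasure (d - 1) := by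
  rcases eq_or_ne v 0 with rfl | hv
  · simp
  have hv' := norm_ne_zero_iff.2 hv
  have h := abs_setIntegral_fderiv_le hd hΩ hb hA hψ hψc (ν := ‖v‖⁻¹ • v)
    (by rw [norm_smul, norm_inv, norm_norm, inv_mul_cancel₀ hv'])
  simp_rw [map_smul, smul_eq_mul] at h
  rwa [integral_const_mul, abs_mul, abs_inv, abs_norm,
    inv_mul_le_iff₀ (norm_pos_iff.2 hv)] at h

/-- Summing the scalar bound over coordinates would lose a dimensional factor. Instead it is applied
for each `z` in the direction `φ z`, at cost `|φ z| ≤ K`; Fubini and the unit mass of the kernel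
then give the constant `K`. -/
lemma setIntegral_divergence_mollify_le (hd : 0 < d) (hΩ : IsOpen Ω)
    (hb : Bornology.IsBounded Ω)
    (hA : Measure.euclideanHausdorffMeasure (d - 1) (frontier Ω) ≠ ∞) {φ : E d → E d}
    (hφ : ContDiff ℝ 1 φ) (hc : HasCompactSupport φ) {K : ℝ} (hK : ∀ x, ‖φ x‖ ≤ K) (n : ℕ) :
    ∫ x in Ω, divergence (mollify n φ) x ≤
      K * (Measure.euclideanHausdorffMeasure (d - 1)).real (frontier Ω) := by
  set μ : Measure (E d) := (Measure.euclideanHausdorffMeasure (d - 1)).restrict (frontier Ω)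
    with hμ
  have : IsFiniteMeasure μ := ⟨by simpa [hμ] using hA.lt_top⟩
  have : IsFiniteMeasure (volume.restrict Ω) := ⟨by simpa using hb.measure_lt_top⟩
  have hK0 : 0 ≤ K := (norm_nonneg _).trans (hK 0)
  have hDk : Continuous (fderiv ℝ (kernel n : E d → ℝ)) :=
    (contDiff_kernel n).continuous_fderiv one_ne_zero
  obtain ⟨B, hB⟩ := ((hasCompactSupport_kernel n).fderiv ℝ).exists_bound_of_continuous
    (f := fderiv ℝ (kernel n : E d → ℝ)) hDk
  simp_rw [divergence_mollify_eq_integral_fderiv n hφ]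
  have hI1 : Integrable (fun p : E d × E d => fderiv ℝ (fun y => kernel n (p.2 - y)) p.1 (φ p.2))
      ((volume.restrict Ω).prod volume) := by
    have h1 : Integrable (fun p : E d × E d => B * ‖φ p.2‖) ((volume.restrict Ω).prod volume) := by
      have h2 := (integrable_const (μ := volume.restrict Ω) B).mul_prod
        (hφ.continuous.norm.integrable_of_hasCompactSupport (μ := volume) hc.norm)
      exact h2
    refine h1.mono' ?_ (Eventually.of_forall fun p => ?_)
    · simp_rw [fderiv_kernel_sub]
      refine Continuous.aestronglyMeasurable ?_
      exact ((hDk.comp (continuous_snd.sub continuous_fst)).neg).clm_apply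
        (hφ.continuous.comp continuous_snd)
    · rw [fderiv_kernel_sub]
      refine (ContinuousLinearMap.le_opNorm _ _).trans ?_
      rw [norm_neg]
      exact mul_le_mul_of_nonneg_right (hB _) (norm_nonneg _)
  have hker : ∀ x : E d, Integrable fun z => kernel n (z - x) := fun x => by
    simp_rw [kernel_sub_comm n _ x]
    exact (contDiff_kernel_sub n x).continuous.integrable_of_hasCompactSupport
      (hasCompactSupport_kernel_sub n x)
  have hone : ∀ x : E d, ∫ z, kernel n (z - x) = 1 := fun x => by
    simp_rw [kernel_sub_comm n _ x, integral_kernel_sub]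
  have hI2 : Integrable (fun p : E d × E d => kernel n (p.2 - p.1)) (μ.prod volume) := by
    have hm : Continuous fun p : E d × E d => kernel n (p.2 - p.1) :=
      (contDiff_kernel n).continuous.comp (continuous_snd.sub continuous_fst)
    rw [integrable_prod_iff hm.aestronglyMeasurable]
    refine ⟨Eventually.of_forall fun x => hker x, ?_⟩
    simp_rw [Real.norm_of_nonneg (kernel_nonneg n _), hone]
    exact integrable_const 1
  rw [integral_integral_swap hI1]
  calc ∫ z, ∫ x in Ω, fderiv ℝ (fun y => kernel n (z - y)) x (φ z)
      ≤ ∫ z, K * ∫ x, kernel n (z - x) ∂μ := by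
        refine integral_mono hI1.integral_prod_right (hI2.integral_prod_right.const_mul K)
          fun z => ?_
        have h1 := abs_setIntegral_fderiv_apply_le hd hΩ hb hA (contDiff_kernel_sub n z)
          (hasCompactSupport_kernel_sub n z) (φ z)
        simp_rw [abs_of_nonneg (kernel_nonneg n _)] at h1
        exact (le_abs_self _).trans (h1.trans (mul_le_mul_of_nonneg_right (hK z)
          (integral_nonneg fun x => kernel_nonneg n _)))
    _ = K * ∫ x, (∫ z, kernel n (z - x)) ∂μ := by
        rw [integral_const_mul, integral_integral_swap (f := fun x z => kernel n (z - x)) hI2]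
    _ = K * (Measure.euclideanHausdorffMeasure (d - 1)).real (frontier Ω) := by
        simp_rw [hone]
        simp [hμ, measureReal_def]

lemma setIntegral_divergence_le_of_hasCompactSupport (hd : 0 < d) (hΩ : IsOpen Ω)
    (hb : Bornology.IsBounded Ω)
    (hA : Measure.euclideanHausdorffMeasure (d - 1) (frontier Ω) ≠ ∞) {φ : E d → E d}
    (hφ : ContDiff ℝ 1 φ) (hc : HasCompactSupport φ) {K : ℝ} (hK : ∀ x, ‖φ x‖ ≤ K) :
    ∫ x in Ω, divergence φ x ≤
      K * (Measure.euclideanHausdorffMeasure (d - 1)).real (frontier Ω) :=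
  le_of_tendsto' (tendsto_setIntegral_divergence_mollify hb hφ hc)
    (setIntegral_divergence_mollify_le hd hΩ hb hA hφ hc hK)

lemma setIntegral_divergence_le (hd : 0 < d) (hΩ : IsOpen Ω)
    (hA : Measure.euclideanHausdorffMeasure (d - 1) (frontier Ω) ≠ ∞) {f : E d → E d}
    (hf : ContDiff ℝ 1 f) {c : E d} {r s K : ℝ} (hr : 0 < r) (hrs : r < s)
    (hΩr : Ω ⊆ Metric.closedBall c r) (hK : ∀ x ∈ Metric.closedBall c s, ‖f x‖ ≤ K) :
    ∫ x in Ω, divergence f x ≤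
      K * (Measure.euclideanHausdorffMeasure (d - 1)).real (frontier Ω) := by
  -- The cutoff equals `1` on `Ω` and vanishes off the ball of radius `s`, so only the size of `f`
  -- on that ball matters.
  set χ : ContDiffBump c := ⟨r, s, hr, hrs⟩
  have h1 : ∀ x ∈ Ω, divergence (fun x => χ x • f x) x = divergence f x := fun x hx => by
    have h2 : (fun x => χ x • f x) =ᶠ[𝓝 x] f := by
      filter_upwards [hΩ.mem_nhds hx] with y hy
      rw [χ.one_of_mem_closedBall (hΩr hy), one_smul]
    rw [divergence_eq_pairing, divergence_eq_pairing, h2.fderiv_eq]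
  rw [← setIntegral_congr_fun hΩ.measurableSet h1]
  refine setIntegral_divergence_le_of_hasCompactSupport hd hΩ
    (Metric.isBounded_closedBall.subset hΩr) hA (χ.contDiff.smul hf) ?_ fun x => ?_
  · exact χ.hasCompactSupport.mono' fun x hx =>
      subset_tsupport _ (Function.mem_support.2 fun h0 => hx (by simp [h0]))
  · have hK0 : 0 ≤ K := (norm_nonneg _).trans (hK c (Metric.mem_closedBall_self (hr.trans hrs).le))
    rw [Pi.smul_apply', norm_smul, Real.norm_of_nonneg χ.nonneg]
    by_cases hx : x ∈ Metric.closedBall c s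
    · exact (mul_le_of_le_one_left (norm_nonneg _) χ.le_one).trans (hK x hx)
    · rw [χ.zero_of_le_dist (not_le.1 (fun h => hx h)).le, zero_mul]
      exact hK0

end DivergenceBound

/-! ### Limits of nonnegative densities are measures -/

section Limits

variable {d : ℕ}

-- A nonnegative distribution is a measure. A cutoff bounds the masses of the densities on compact
-- sets, so integrals of continuous test functions are eventually bounded and converge along an
-- ultrafilter. The limit is linear and positive, Riesz represents it, and on `C¹` functions it must
-- equal `T`.
open CompactlySupported in
lemma exists_measure_of_tendsto_integral_mul {ρ : ℕ → E d → ℝ} (hρ : ∀ n, Continuous (ρ n))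
    (hρ0 : ∀ᶠ n in atTop, ∀ x, 0 ≤ ρ n x) {T : (E d → ℝ) → ℝ}
    (hT : ∀ φ : E d → ℝ, ContDiff ℝ 1 φ → HasCompactSupport φ →
      Tendsto (fun n => ∫ x, φ x * ρ n x) atTop (𝓝 (T φ))) :
    ∃ μ : Measure (E d), IsFiniteMeasureOnCompacts μ ∧
      ∀ φ : E d → ℝ, ContDiff ℝ 1 φ → HasCompactSupport φ → ∫ x, φ x ∂μ = T φ := by
  have hU : (hyperfilter ℕ : Filter ℕ) ≤ atTop := Nat.hyperfilter_le_atTop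
  have hint : ∀ (f : C_c(E d, ℝ)) n, Integrable fun x => f x * ρ n x := fun f n =>
    (f.continuous.mul (hρ n)).integrable_of_hasCompactSupport f.hasCompactSupport.mul_right
  have hex : ∀ f : C_c(E d, ℝ), ∃ l, Tendsto (fun n => ∫ x, f x * ρ n x) (hyperfilter ℕ) (𝓝 l) := by
    intro f
    obtain ⟨r, hr⟩ := f.hasCompactSupport.isCompact.isBounded.subset_closedBall (0 : E d)
    set χ : ContDiffBump (0 : E d) :=
      ⟨max r 1, max r 1 + 1, by positivity, by linarith⟩
    obtain ⟨B, hB⟩ := f.hasCompactSupport.exists_bound_of_continuous f.continuous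
    have hB0 : 0 ≤ B := (norm_nonneg _).trans (hB 0)
    have hfχ : ∀ x, ‖f x‖ ≤ B * χ x := fun x => by
      by_cases hx : x ∈ tsupport f
      · rw [χ.one_of_mem_closedBall
          (Metric.closedBall_subset_closedBall (le_max_left r 1) (hr hx)), mul_one]
        exact hB x
      · rw [image_eq_zero_of_notMem_tsupport hx, norm_zero]
        exact mul_nonneg hB0 χ.nonneg
    have hTχ := hT χ χ.contDiff χ.hasCompactSupport
    have hbd : ∀ᶠ n in atTop, (∫ x, f x * ρ n x) ∈ Icc (-(B * (T χ + 1))) (B * (T χ + 1)) := by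
      filter_upwards [hρ0, hTχ.eventually_lt_const (lt_add_one (T χ))] with n hn0 hn
      rw [mem_Icc, ← abs_le, ← Real.norm_eq_abs]
      refine (norm_integral_le_of_norm_le (g := fun x => B * (χ x * ρ n x)) ?_
        (Eventually.of_forall fun x => ?_)).trans ?_
      · exact ((χ.continuous.mul (hρ n)).integrable_of_hasCompactSupport
          χ.hasCompactSupport.mul_right).const_mul B
      · rw [norm_mul, Real.norm_of_nonneg (hn0 x), ← mul_assoc]
        exact mul_le_mul_of_nonneg_right (hfχ x) (hn0 x)
      · rw [integral_const_mul]
        exact mul_le_mul_of_nonneg_left hn.le hB0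
    obtain ⟨l, -, hl⟩ := isCompact_Icc.ultrafilter_le_nhds
      ((hyperfilter ℕ).map fun n => ∫ x, f x * ρ n x)
      (le_principal_iff.2 (hU hbd))
    exact ⟨l, hl⟩
  choose Λ hΛ using hex
  let Λl : C_c(E d, ℝ) →ₗ[ℝ] ℝ :=
    { toFun := Λ
      map_add' := fun f g => by
        refine tendsto_nhds_unique (hΛ (f + g)) (((hΛ f).add (hΛ g)).congr fun n => ?_)
        rw [← integral_add (hint f n) (hint g n)]
        simp [add_mul]
      map_smul' := fun c f => by
        refine tendsto_nhds_unique (hΛ (c • f)) (((hΛ f).const_mul c).congr fun n => ?_)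
        rw [← integral_const_mul]
        simp [mul_assoc] }
  let Λp : C_c(E d, ℝ) →ₚ[ℝ] ℝ := PositiveLinearMap.mk₀ Λl fun f hf => by
    refine ge_of_tendsto (hΛ f) (hU ?_)
    filter_upwards [hρ0] with n hn
    exact integral_nonneg fun x => mul_nonneg (hf x) (hn x)
  refine ⟨RealRMK.rieszMeasure Λp, inferInstance, fun φ hφ hc => ?_⟩
  have h1 := RealRMK.integral_rieszMeasure Λp ⟨⟨φ, hφ.continuous⟩, hc⟩
  refine Eq.trans h1 (tendsto_nhds_unique (hΛ ⟨⟨φ, hφ.continuous⟩, hc⟩) ?_)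
  exact (hT φ hφ hc).mono_left hU

end Limits

/-! ### Local bounded variation -/

section LocalBV

variable {d : ℕ} {H : E d → ℝ} {u₀ : E d → ℝ} {M : ℝ≥0} {t : ℝ}

/-- The rank-one map `v ↦ ⟨p, v⟩ a`. -/
def rankOneMap (p a : E d) : E d →L[ℝ] E d := (innerSL ℝ p).smulRight a

lemma rankOneMap_apply (p a v : E d) : rankOneMap p a v = (inner ℝ p v : ℝ) • a := rfl

lemma pairing_rankOneMap (p a : E d) (A : E d →L[ℝ] E d) :
    pairing (rankOneMap p a) A = inner ℝ a (A p) := by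
  have h := sum_smul_single (InnerProductSpace.toDual ℝ (E d) p : E d →L[ℝ] ℝ)
  rw [LinearIsometryEquiv.symm_apply_apply] at h
  rw [pairing_apply]
  conv_rhs => rw [← h, map_sum, inner_sum]
  refine Finset.sum_congr rfl fun j _ => ?_
  rw [rankOneMap_apply, map_smul, real_inner_smul_left, inner_smul_right]
  rfl

lemma norm_rankOneMap_le (p a : E d) : ‖rankOneMap p a‖ ≤ ‖p‖ * ‖a‖ := by
  rw [rankOneMap, ContinuousLinearMap.norm_smulRight_apply, innerSL_apply_norm]


lemma continuous_apply_gradient (C : E d →L[ℝ] E d) {φ : E d → ℝ} (hφ : ContDiff ℝ 1 φ) :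
    Continuous fun x => C (gradient φ x) := C.continuous.comp (continuous_gradient hφ)

lemma hasCompactSupport_apply_gradient (C : E d →L[ℝ] E d) {φ : E d → ℝ}
    (hc : HasCompactSupport φ) : HasCompactSupport fun x => C (gradient φ x) :=
  (hc.fderiv ℝ).comp_left (g := fun l => C ((InnerProductSpace.toDual ℝ (E d)).symm l)) (by simp)

lemma pairing_fderiv_smulRight (C : E d →L[ℝ] E d) (φ : E d → ℝ) (x a : E d) :
    pairing C ((fderiv ℝ φ x).smulRight a) = inner ℝ (C (gradient φ x)) a :=
  pairing_smulRight C (fderiv ℝ φ x) a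

lemma tendsto_integral_mul_pairing_mollify {F : E d → E d} (hF : AEStronglyMeasurable F) {B : ℝ}
    (hB : ∀ x, ‖F x - x‖ ≤ B) (C : E d →L[ℝ] E d) {φ : E d → ℝ} (hφ : ContDiff ℝ 1 φ)
    (hc : HasCompactSupport φ) :
    Tendsto (fun n => ∫ x, φ x * pairing C (fderiv ℝ (mollify n F) x)) atTop
      (𝓝 (-∫ x, inner ℝ (C (gradient φ x)) (F x))) := by
  have h := tendsto_integral_inner_mollify hF hB (continuous_apply_gradient C hφ)
    (hasCompactSupport_apply_gradient C hc)
  refine h.neg.congr fun n => ?_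
  rw [integral_mul_pairing_fderiv C hφ
    (contDiff_mollify n (locallyIntegrable_of_norm_sub_le hF hB)) (Or.inl hc)]
  simp_rw [pairing_fderiv_smulRight]

lemma exists_measure_integral_eq {F : E d → E d} (hF : AEStronglyMeasurable F) {B : ℝ}
    (hB : ∀ x, ‖F x - x‖ ≤ B) {C : E d →L[ℝ] E d}
    (hC : ∀ᶠ n in atTop, ∀ x, 0 ≤ pairing C (fderiv ℝ (mollify n F) x)) :
    ∃ μ : Measure (E d), IsFiniteMeasureOnCompacts μ ∧
      ∀ φ : E d → ℝ, ContDiff ℝ 1 φ → HasCompactSupport φ →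
        ∫ x, φ x ∂μ = -∫ x, inner ℝ (C (gradient φ x)) (F x) :=
  exists_measure_of_tendsto_integral_mul
    (fun n => (pairing C).continuous.comp ((contDiff_mollify n
      (locallyIntegrable_of_norm_sub_le hF hB)).continuous_fderiv one_ne_zero)) hC
    fun _ hφ hc => tendsto_integral_mul_pairing_mollify hF hB C hφ hc

lemma inner_rankOneMap_single_gradient {φ : E d → ℝ} (i j : Fin d) (x a : E d) :
    inner ℝ (rankOneMap (EuclideanSpace.single j 1) (EuclideanSpace.single i 1) (gradient φ x)) a =
      a i * fderiv ℝ φ x (EuclideanSpace.single j 1) := by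
  rw [rankOneMap_apply, real_inner_smul_left, real_inner_comm, gradient,
    InnerProductSpace.toDual_symm_apply, EuclideanSpace.inner_single_left]
  simp [mul_comm]

lemma integral_coord_mul_fderiv {φ : E d → ℝ} (hφ : ContDiff ℝ 1 φ) (hc : HasCompactSupport φ)
    (i j : Fin d) :
    ∫ x, x i * fderiv ℝ φ x (EuclideanSpace.single j 1) =
      -((EuclideanSpace.single j 1 : E d) i * ∫ x, φ x) := by
  have h := integral_mul_pairing_fderiv
    (rankOneMap (EuclideanSpace.single j 1) (EuclideanSpace.single i 1)) hφ contDiff_id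
    (F := fun x : E d => x) (Or.inl hc)
  simp_rw [pairing_fderiv_smulRight, inner_rankOneMap_single_gradient, pairing_rankOneMap,
    fderiv_fun_id, ContinuousLinearMap.id_apply, EuclideanSpace.inner_single_left] at h
  rw [integral_mul_const, map_one, one_mul] at h
  linarith

/-- Both `div F` and `div F + λ ∂_j F_i` are nonnegative distributions, by the divergence domination
with `B = 0` and `B = -e`, where `e` is the rank-one map with `‖e‖ ≤ 1` that selects `∂_j F_i`.
Hence `∂_j F_i` is `λ⁻¹` times a difference of measures. Here any radius above `M` serves; `M + 1`
is taken. -/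
lemma exists_measures_foot (hd : 0 < d) (hH : Admissible H) (hu₀ : LipschitzWith M u₀)
    (ht : 0 < t) (i j : Fin d) :
    ∃ (c : ℝ) (μ ν : Measure (E d)), IsFiniteMeasureOnCompacts μ ∧ IsFiniteMeasureOnCompacts ν ∧
      ∀ φ : E d → ℝ, ContDiff ℝ 1 φ → HasCompactSupport φ →
        ∫ x, foot H u₀ t x i * fderiv ℝ φ x (EuclideanSpace.single j 1) =
          c * ((∫ x, φ x ∂μ) - ∫ x, φ x ∂ν) := by
  have hR : (0 : ℝ) < M + 1 := by positivity
  have hR' : (M : ℝ) < M + 1 := lt_add_one _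
  set c := (dirConvexityConst H (M + 1)).toReal
  have hc : 0 < c := ENNReal.toReal_pos (hH.dirConvexityConst_pos hR).ne'
    (dirConvexityConst_lt_top hd hR).ne
  set e : E d →L[ℝ] E d := rankOneMap (EuclideanSpace.single j 1) (EuclideanSpace.single i 1)
  have he : ‖e‖ ≤ 1 := (norm_rankOneMap_le _ _).trans (by simp)
  have hev := eventually_mul_pairing_fderiv_mollify_le (u₀ := u₀) hH hu₀ ht hR'
  obtain ⟨B, hB⟩ := exists_norm_foot_sub_le (u₀ := u₀) hH hu₀ ht
  have hm : AEStronglyMeasurable (foot H u₀ t) := (measurable_foot hH).aestronglyMeasurable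
  obtain ⟨μ, hμ, hμφ⟩ := exists_measure_integral_eq (C := ContinuousLinearMap.id ℝ (E d)) hm hB
    (hev.mono fun n hn z => by simpa [pairing_apply] using hn 0 (by simp) z)
  obtain ⟨ν, hν, hνφ⟩ := exists_measure_integral_eq (C := ContinuousLinearMap.id ℝ (E d) + c • e)
    hm hB (hev.mono fun n hn z => by
      have h := hn ((-1 : ℝ) • e) (by simpa [norm_smul] using he) z
      rw [pairing_smul] at h
      rw [pairing_add, pairing_smul]
      linarith)
  refine ⟨c⁻¹, μ, ν, hμ, hν, fun φ hφ hcs => ?_⟩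
  have hli := locallyIntegrable_foot (u₀ := u₀) hH hu₀ ht
  have hint : ∀ C : E d →L[ℝ] E d,
      Integrable fun x => inner ℝ (C (gradient φ x)) (foot H u₀ t x) := fun C => by
    have h1 : Integrable fun x => ‖C (gradient φ x)‖ • foot H u₀ t x :=
      hli.integrable_smul_left_of_hasCompactSupport (continuous_apply_gradient C hφ).norm
        (hasCompactSupport_apply_gradient C hcs).norm
    refine h1.mono ((continuous_apply_gradient C hφ).aestronglyMeasurable.inner hm)
      (Eventually.of_forall fun x => ?_)
    rw [norm_smul, norm_norm]
    exact norm_inner_le_norm _ _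
  rw [hμφ φ hφ hcs, hνφ φ hφ hcs]
  have h1 : ∀ x, inner ℝ ((ContinuousLinearMap.id ℝ (E d) + c • e) (gradient φ x))
      (foot H u₀ t x) = inner ℝ (ContinuousLinearMap.id ℝ (E d) (gradient φ x)) (foot H u₀ t x) +
      c * (foot H u₀ t x i * fderiv ℝ φ x (EuclideanSpace.single j 1)) := fun x => by
    rw [add_apply, inner_add_left, smul_apply, real_inner_smul_left,
      inner_rankOneMap_single_gradient]
  have hi2 : Integrable fun x => foot H u₀ t x i * fderiv ℝ φ x (EuclideanSpace.single j 1) :=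
    (hint e).congr (Eventually.of_forall fun x => inner_rankOneMap_single_gradient i j x _)
  simp_rw [h1]
  rw [integral_add (hint _) (hi2.const_mul c), integral_const_mul]
  field_simp
  ring

lemma integrableOn_slope (hH : Admissible H) (hu₀ : LipschitzWith M u₀) (ht : 0 < t)
    {Ω : Set (E d)} (hb : Bornology.IsBounded Ω) : IntegrableOn (slope H u₀ t) Ω := by
  obtain ⟨B, hB⟩ := exists_norm_slope_le (u₀ := u₀) hH hu₀ ht
  exact Measure.integrableOn_of_bounded hb.measure_lt_top.ne
    (measurable_slope hH).aestronglyMeasurable (M := B) (Eventually.of_forall hB)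

lemma isLocallyBV_slope (hd : 0 < d) (hH : Admissible H) (hu₀ : LipschitzWith M u₀)
    (ht : 0 < t) : IsLocallyBV (slope H u₀ t) := by
  intro Ω hΩ hb
  refine ⟨integrableOn_slope hH hu₀ ht hb, ?_⟩
  choose c μ ν hμ hν h using exists_measures_foot (u₀ := u₀) hd hH hu₀ ht
  have hfin : ∀ (ρ : Measure (E d)) [IsFiniteMeasureOnCompacts ρ],
      IsFiniteMeasure (ρ.restrict Ω) := fun ρ _ =>
    ⟨by simpa using hb.measure_lt_top⟩
  have hfv := hfin volume
  have hfμ : ∀ i j, IsFiniteMeasure ((μ i j).restrict Ω) := fun i j => hfin _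
  have hfν : ∀ i j, IsFiniteMeasure ((ν i j).restrict Ω) := fun i j => hfin _
  -- From `b = (x - F)/t`: the identity contributes Lebesgue measure on the diagonal, and the foot
  -- contributes the measures above. Restricting to the bounded set `Ω` makes all of them finite.
  refine ⟨fun i j => t⁻¹ • ((EuclideanSpace.single j 1 : E d) i •
    (volume.restrict Ω).toSignedMeasure + c i j • (((μ i j).restrict Ω).toSignedMeasure -
      ((ν i j).restrict Ω).toSignedMeasure)), fun i j φ hφ hc hs => ?_⟩
  have hφ0 : ∀ x ∉ Ω, φ x = 0 := fun x hx => image_eq_zero_of_notMem_tsupport fun h => hx (hs h)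
  have hφ0' : ∀ x ∉ Ω, fderiv ℝ φ x = 0 := fun x hx =>
    image_eq_zero_of_notMem_tsupport fun h => hx (hs (tsupport_fderiv_subset ℝ h))
  have hI : ∀ (ρ : Measure (E d)) [IsFiniteMeasureOnCompacts ρ] [IsFiniteMeasure (ρ.restrict Ω)],
      (ρ.restrict Ω).toSignedMeasure.Integrable φ := fun ρ _ _ => by
    rw [VectorMeasure.Integrable, Measure.variation_toSignedMeasure]
    exact (hφ.continuous.integrable_of_hasCompactSupport hc).mono_measure Measure.restrict_le_self
  have hR : ∀ (ρ : Measure (E d)) [IsFiniteMeasure (ρ.restrict Ω)],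
      ∫ᵛ x, φ x ∂<•(ρ.restrict Ω).toSignedMeasure = ∫ x, φ x ∂ρ := fun ρ _ => by
    rw [VectorMeasure.integral_toSignedMeasure, setIntegral_eq_integral_of_forall_compl_eq_zero hφ0]
  rw [VectorMeasure.integral_smul_vectorMeasure, VectorMeasure.integral_add_vectorMeasure
    ((hI volume).smul_vectorMeasure _)
    (((hI _).sub_vectorMeasure (hI _)).smul_vectorMeasure _),
    VectorMeasure.integral_smul_vectorMeasure, VectorMeasure.integral_smul_vectorMeasure,
    VectorMeasure.integral_sub_vectorMeasure (hI _) (hI _), hR, hR, hR,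
    setIntegral_eq_integral_of_forall_compl_eq_zero fun x hx => by
      rw [hφ0' x hx, zero_apply, mul_zero]]
  simp only [smul_eq_mul]
  have hDc : Continuous fun x => fderiv ℝ φ x (EuclideanSpace.single j 1) :=
    (hφ.continuous_fderiv one_ne_zero).clm_apply continuous_const
  have hDs : HasCompactSupport fun x => fderiv ℝ φ x (EuclideanSpace.single j 1) :=
    (hc.fderiv ℝ).comp_left (g := fun l : E d →L[ℝ] ℝ => l (EuclideanSpace.single j 1)) (by simp)
  have hi1 : Integrable fun x : E d => x i * fderiv ℝ φ x (EuclideanSpace.single j 1) :=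
    Continuous.integrable_of_hasCompactSupport (by fun_prop) hDs.mul_left
  have hi2 : Integrable fun x => foot H u₀ t x i * fderiv ℝ φ x (EuclideanSpace.single j 1) := by
    have h1 : Integrable fun x => fderiv ℝ φ x (EuclideanSpace.single j 1) • foot H u₀ t x :=
      (locallyIntegrable_foot hH hu₀ ht).integrable_smul_left_of_hasCompactSupport hDc hDs
    refine ((EuclideanSpace.proj (𝕜 := ℝ) i).integrable_comp h1).congr
      (Eventually.of_forall fun x => ?_)
    simp [mul_comm]
  have h2 : ∀ x, slope H u₀ t x i * fderiv ℝ φ x (EuclideanSpace.single j 1) =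
      t⁻¹ * (x i * fderiv ℝ φ x (EuclideanSpace.single j 1) -
        foot H u₀ t x i * fderiv ℝ φ x (EuclideanSpace.single j 1)) := fun x => by
    rw [← inv_smul_sub_foot ht x, PiLp.smul_apply, PiLp.sub_apply, smul_eq_mul]
    ring
  simp_rw [h2]
  rw [integral_const_mul, integral_sub hi1 hi2, integral_coord_mul_fderiv hφ hc,
    h i j φ hφ hc]
  ring

end LocalBV

/-! ### Normalized Hamiltonians -/

section Normalized

variable {d : ℕ} {H : E d → ℝ} {u₀ : E d → ℝ} {M : ℝ≥0} {t : ℝ}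

/-- The critical point `0` is a global minimum; another zero of `H` would also be a minimum, hence
critical, against injectivity of `DH`. -/
lemma hamiltonian_pos (hH : Admissible H) (h0 : H 0 = 0) (hg : gradient H 0 = 0) {p : E d}
    (hp : p ≠ 0) : 0 < H p := by
  have h1 : ∀ p', -H p' ≤ 0 := fun p' => by
    simpa [hg, h0] using isMax_gradient hH 0 p'
  refine lt_of_le_of_ne (by linarith [h1 p]) fun h => hp (gradient_injective hH ?_)
  rw [hg]
  refine gradient_eq_of_isMax hH fun p' => ?_
  simpa [← h] using h1 p'

lemma legendre_zero (hH : Admissible H) (h0 : H 0 = 0) (hg : gradient H 0 = 0) :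
    legendre H 0 = 0 := by
  have := legendre_gradient hH 0
  simpa [hg, h0] using this

lemma gradient_legendre_ne_zero (hH : Admissible H) (hg : gradient H 0 = 0) {q : E d}
    (hq : q ≠ 0) : gradient (legendre H) q ≠ 0 := fun h => hq (by
  rw [← gradient_gradient_legendre hH q, h, hg])

lemma legendre_lt (hH : Admissible H) (h0 : H 0 = 0) (hg : gradient H 0 = 0) {q : E d}
    (hq : q ≠ 0) : legendre H q < ‖gradient (legendre H) q‖ * ‖q‖ := by
  have h1 := hamiltonian_pos hH h0 hg (gradient_legendre_ne_zero hH hg hq)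
  rw [legendre_eq hH]
  linarith [real_inner_le_norm (gradient (legendre H) q) q]

lemma bddAbove_speeds (hH : Admissible H) (M : ℝ) :
    BddAbove {r : ℝ | ∃ q : E d, legendre H q ≤ M * ‖q‖ ∧ r = ‖q‖} := by
  obtain ⟨C, hC⟩ := exists_mul_norm_sub_le_legendre hH (M + 1)
  refine ⟨C, ?_⟩
  rintro _ ⟨q, hq, rfl⟩
  linarith [hC q]

lemma norm_le_speedBound (hH : Admissible H) {M : ℝ} {q : E d} (hq : legendre H q ≤ M * ‖q‖) :
    ‖q‖ ≤ speedBound H M :=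
  le_csSup (bddAbove_speeds hH M) ⟨q, hq, rfl⟩

lemma speedBound_nonneg (hH : Admissible H) (h0 : H 0 = 0) (hg : gradient H 0 = 0) (M : ℝ) :
    0 ≤ speedBound H M := by
  have := norm_le_speedBound hH (M := M) (q := 0) (by simp [legendre_zero hH h0 hg])
  simpa using this

/-- Since `DL` is continuous and `DL(0) = 0`, small nonzero `q` satisfy `L(q) ≤ |DL(q)||q| ≤ M|q|`.
-/
lemma speedBound_pos (hd : 0 < d) (hH : Admissible H) (h0 : H 0 = 0) (hg : gradient H 0 = 0)
    {M : ℝ} (hM : 0 < M) : 0 < speedBound H M := by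
  have : Nonempty (Fin d) := ⟨⟨0, hd⟩⟩
  have hP0 : gradient (legendre H) 0 = 0 := by
    have := gradient_legendre_gradient hH 0
    rwa [hg] at this
  have hc := (continuous_gradient_legendre hH).tendsto 0
  rw [hP0] at hc
  obtain ⟨δ, hδ, h⟩ := Metric.eventually_nhds_iff.1 (hc.eventually (Metric.ball_mem_nhds _ hM))
  obtain ⟨q, hq⟩ := exists_norm_eq (E d) (half_pos hδ).le
  have hq0 : q ≠ 0 := by rw [← norm_pos_iff, hq]; exact half_pos hδ
  have h1 : ‖gradient (legendre H) q‖ < M := by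
    have := h (y := q) (by rw [dist_zero_right, hq]; exact half_lt_self hδ)
    simpa using this
  have h2 := norm_le_speedBound hH (M := M) (q := q) ((legendre_lt hH h0 hg hq0).le.trans
    (mul_le_mul_of_nonneg_right h1.le (norm_nonneg q)))
  linarith

lemma norm_gradient_le_momentumBound (hH : Admissible H) {M : ℝ} {q : E d}
    (hq : ‖q‖ ≤ speedBound H M) : ‖gradient (legendre H) q‖ ≤ momentumBound H M := by
  refine le_csSup ?_ ⟨q, hq, rfl⟩
  obtain ⟨B, hB⟩ := ((isCompact_closedBall (0 : E d) (speedBound H M)).image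
    (continuous_gradient_legendre hH).norm).bddAbove
  refine ⟨B, ?_⟩
  rintro _ ⟨q, hq, rfl⟩
  exact hB (mem_image_of_mem _ (by simpa using hq))

/-- On the sphere `|q| = Λ_M` one has `M|q| ≤ L(q) < |DL(q)||q|`. The first inequality is the limit
`s ↓ 1` of `L(sq) > M|sq|`, which holds by maximality of `Λ_M`. The strict inequality supplies the
room above `M` that the monotonicity argument needs. -/
lemma lt_momentumBound (hd : 0 < d) (hH : Admissible H) (h0 : H 0 = 0) (hg : gradient H 0 = 0)
    {M : ℝ} (hM : 0 < M) : M < momentumBound H M := by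
  have : Nonempty (Fin d) := ⟨⟨0, hd⟩⟩
  have hΛ := speedBound_pos hd hH h0 hg hM
  obtain ⟨q, hq⟩ := exists_norm_eq (E d) hΛ.le
  have hq0 : q ≠ 0 := by rw [← norm_pos_iff, hq]; exact hΛ
  have h1 : M * ‖q‖ ≤ legendre H q := by
    have hl1 : Tendsto (fun s : ℝ => M * ‖s • q‖) (𝓝[>] 1) (𝓝 (M * ‖q‖)) :=
      (Continuous.tendsto' (by fun_prop) _ _ (by simp)).mono_left nhdsWithin_le_nhds
    have hl2 : Tendsto (fun s : ℝ => legendre H (s • q)) (𝓝[>] 1) (𝓝 (legendre H q)) :=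
      (Continuous.tendsto' ((continuous_legendre hH).comp (by fun_prop)) _ _
        (by simp)).mono_left nhdsWithin_le_nhds
    refine le_of_tendsto_of_tendsto hl1 hl2 ?_
    filter_upwards [self_mem_nhdsWithin] with s (hs : 1 < s)
    by_contra! hlt
    have h2 := norm_le_speedBound hH hlt.le
    rw [norm_smul, Real.norm_of_nonneg (by linarith), hq] at h2
    nlinarith
  have h2 := h1.trans_lt (legendre_lt hH h0 hg hq0)
  exact (lt_of_mul_lt_mul_right h2 (norm_nonneg q)).trans_le
    (norm_gradient_le_momentumBound hH hq.le)

lemma norm_slope_le_speedBound (hH : Admissible H) (hu₀ : LipschitzWith M u₀) (ht : 0 < t)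
    (h0 : H 0 = 0) (hg : gradient H 0 = 0) (x : E d) :
    ‖slope H u₀ t x‖ ≤ speedBound H M := by
  by_cases hx : DifferentiableAt ℝ (hopfLax H u₀ t) x
  · refine norm_le_speedBound hH ?_
    -- The competitor `y = x` costs only `u₀(x)` because `L(0) = 0`; hence `t L(b) ≤ u₀(x) - u₀(x -
    -- tb) ≤ M t |b|`.
    have h1 := hopfLax_le hH hu₀ ht x x
    rw [hopfLax_eq_cost_foot hH hu₀ ht hx, cost, cost, inv_smul_sub_foot ht, sub_self, smul_zero,
      legendre_zero hH h0 hg, mul_zero, add_zero] at h1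
    have h2 := hu₀.dist_le_mul x (foot H u₀ t x)
    rw [Real.dist_eq, dist_eq_norm, foot, sub_sub_cancel, norm_smul, Real.norm_of_nonneg ht.le,
      ← foot] at h2
    have h3 : t * legendre H (slope H u₀ t x) ≤ t * (M * ‖slope H u₀ t x‖) := by
      linarith [(abs_le.1 h2).2]
    exact le_of_mul_le_mul_left h3 ht
  · have h1 : gradient (hopfLax H u₀ t) x = 0 := by
      rw [gradient, fderiv_zero_of_not_differentiableAt hx, map_zero]
    rw [slope, h1, hg, norm_zero]
    exact speedBound_nonneg hH h0 hg M

lemma norm_foot_sub_le (hH : Admissible H) (hu₀ : LipschitzWith M u₀) (ht : 0 < t)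
    (h0 : H 0 = 0) (hg : gradient H 0 = 0) (x : E d) :
    ‖foot H u₀ t x - x‖ ≤ t * speedBound H M := by
  rw [foot, sub_sub_cancel_left, norm_neg, norm_smul, Real.norm_of_nonneg ht.le]
  exact mul_le_mul_of_nonneg_left (norm_slope_le_speedBound hH hu₀ ht h0 hg x) ht.le

end Normalized

/-! ### The total variation estimate -/

section TotalVariation

variable {d : ℕ} {Ω : Set (E d)}

/-- The linear map with rows `φ i x`. -/
def rowMap (φ : Fin d → E d → E d) (x : E d) : E d →L[ℝ] E d :=
  ∑ i, rankOneMap (φ i x) (EuclideanSpace.single i 1)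

/-- The vector field with components the divergences of the rows. -/
def rowDivergence (φ : Fin d → E d → E d) (x : E d) : E d :=
  WithLp.toLp 2 fun i => divergence (φ i) x

lemma pairing_sum {ι : Type*} (s : Finset ι) (C : ι → E d →L[ℝ] E d) (A : E d →L[ℝ] E d) :
    pairing (∑ i ∈ s, C i) A = ∑ i ∈ s, pairing (C i) A := by
  simp only [pairing_apply, _root_.sum_apply, sum_inner]
  exact Finset.sum_comm

lemma pairing_rowMap (φ : Fin d → E d → E d) (x : E d) (A : E d →L[ℝ] E d) :
    pairing (rowMap φ x) A = ∑ i, A (φ i x) i := by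
  rw [rowMap, pairing_sum]
  refine Finset.sum_congr rfl fun i _ => ?_
  rw [pairing_rankOneMap, EuclideanSpace.inner_single_left, map_one, one_mul]

lemma rowMap_apply (φ : Fin d → E d → E d) (x v : E d) (i : Fin d) :
    rowMap φ x v i = inner ℝ (φ i x) v := by
  simp [rowMap, rankOneMap_apply, Pi.single_apply]

/-- The operator norm is at most the Frobenius norm, so the test fields for the total variation are
admissible as `B` in the divergence domination. -/
lemma norm_rowMap_le {φ : Fin d → E d → E d} {x : E d} (h : ∑ i, ‖φ i x‖ ^ 2 ≤ 1) :
    ‖rowMap φ x‖ ≤ 1 := by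
  refine ContinuousLinearMap.opNorm_le_bound _ zero_le_one fun v => ?_
  rw [one_mul, EuclideanSpace.norm_eq]
  refine Real.sqrt_le_iff.2 ⟨norm_nonneg _, ?_⟩
  calc ∑ i, ‖rowMap φ x v i‖ ^ 2 ≤ ∑ i, ‖φ i x‖ ^ 2 * ‖v‖ ^ 2 := by
        refine Finset.sum_le_sum fun i _ => ?_
        rw [rowMap_apply, ← mul_pow]
        exact pow_le_pow_left₀ (norm_nonneg _) (norm_inner_le_norm _ _) 2
    _ ≤ ‖v‖ ^ 2 := by
        rw [← Finset.sum_mul]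
        exact mul_le_of_le_one_left (sq_nonneg _) h

variable {φ : Fin d → E d → E d}

lemma continuous_rowDivergence (hφ : ∀ i, ContDiff ℝ 1 (φ i)) : Continuous (rowDivergence φ) :=
  (PiLp.continuous_toLp 2 _).comp (continuous_pi fun i => continuous_divergence (hφ i))

lemma hasCompactSupport_rowDivergence (hc : ∀ i, HasCompactSupport (φ i)) :
    HasCompactSupport (rowDivergence φ) := by
  refine HasCompactSupport.intro (K := ⋃ i, tsupport (φ i))
    (isCompact_iUnion fun i => hc i) fun x hx => ?_
  ext i
  have h : fderiv ℝ (φ i) x = 0 := image_eq_zero_of_notMem_tsupport fun h =>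
    hx (mem_iUnion.2 ⟨i, tsupport_fderiv_subset ℝ h⟩)
  simp [rowDivergence, divergence, h]

lemma inner_rowDivergence (x a : E d) :
    inner ℝ (rowDivergence φ x) a = ∑ i, a i * divergence (φ i) x := by
  simp [rowDivergence, PiLp.inner_apply]

lemma integrable_fderiv_apply (hφ : ∀ i, ContDiff ℝ 1 (φ i)) (hc : ∀ i, HasCompactSupport (φ i))
    {F : E d → E d} (hF : ContDiff ℝ 1 F) (i : Fin d) :
    Integrable fun x => fderiv ℝ F x (φ i x) i := by
  refine Continuous.integrable_of_hasCompactSupport ?_ ((hc i).mono' fun x hx =>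
    subset_tsupport _ (Function.mem_support.2 fun h0 => hx (by simp [h0])))
  exact (EuclideanSpace.proj (𝕜 := ℝ) i).continuous.comp
    ((hF.continuous_fderiv one_ne_zero).clm_apply (hφ i).continuous)

lemma integrable_pairing_rowMap (hφ : ∀ i, ContDiff ℝ 1 (φ i))
    (hc : ∀ i, HasCompactSupport (φ i)) {F : E d → E d} (hF : ContDiff ℝ 1 F) :
    Integrable fun x => pairing (rowMap φ x) (fderiv ℝ F x) := by
  simp_rw [pairing_rowMap]
  exact integrable_finsetSum _ fun i _ => integrable_fderiv_apply hφ hc hF i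

lemma integral_inner_rowDivergence (hφ : ∀ i, ContDiff ℝ 1 (φ i))
    (hc : ∀ i, HasCompactSupport (φ i)) {F : E d → E d} (hF : ContDiff ℝ 1 F) :
    ∫ x, inner ℝ (rowDivergence φ x) (F x) = -∫ x, pairing (rowMap φ x) (fderiv ℝ F x) := by
  have hFi : ∀ i, ContDiff ℝ 1 fun x => F x i := fun i =>
    (EuclideanSpace.proj (𝕜 := ℝ) i).contDiff.comp hF
  have hfd : ∀ i x v, fderiv ℝ (fun x => F x i) x v = fderiv ℝ F x v i := fun i x v => by
    have h1 := (EuclideanSpace.proj (𝕜 := ℝ) i).hasFDerivAt.comp x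
      ((hF.differentiable one_ne_zero) x).hasFDerivAt
    have h2 : HasFDerivAt (fun x => F x i)
      ((EuclideanSpace.proj (𝕜 := ℝ) i).comp (fderiv ℝ F x)) x := h1
    rw [h2.fderiv]
    rfl
  simp_rw [inner_rowDivergence, pairing_rowMap]
  have hi1 : ∀ i, Integrable fun x => F x i * divergence (φ i) x := fun i =>
    ((hFi i).continuous.mul (continuous_divergence (hφ i))).integrable_of_hasCompactSupport
      (hasCompactSupport_divergence (hc i)).mul_left
  rw [integral_finsetSum _ fun i _ => hi1 i,
    integral_finsetSum _ fun i _ => integrable_fderiv_apply hφ hc hF i,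
    ← Finset.sum_neg_distrib]
  refine Finset.sum_congr rfl fun i _ => ?_
  have h := integral_mul_pairing_fderiv (ContinuousLinearMap.id ℝ (E d)) (hFi i) (hφ i)
    (Or.inr (hc i))
  simp_rw [pairing_id_smulRight, hfd, ← divergence_eq_pairing] at h
  exact h

lemma rowMap_eq_zero (hs : ∀ i, tsupport (φ i) ⊆ Ω) {x : E d} (hx : x ∉ Ω) :
    rowMap φ x = 0 := by
  refine Finset.sum_eq_zero fun i _ => ?_
  rw [image_eq_zero_of_notMem_tsupport fun h => hx (hs i h)]
  ext v
  simp [rankOneMap_apply]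

/-- The integrand becomes minus the trace of the row matrix, which is at most `√d` times its
Frobenius norm. -/
lemma integral_inner_rowDivergence_id_le (hb : Bornology.IsBounded Ω)
    (hφ : ∀ i, ContDiff ℝ 1 (φ i)) (hc : ∀ i, HasCompactSupport (φ i))
    (hs : ∀ i, tsupport (φ i) ⊆ Ω) (h1 : ∀ x, ∑ i, ‖φ i x‖ ^ 2 ≤ 1) :
    ∫ x, inner ℝ (rowDivergence φ x) x ≤ √d * volume.real Ω := by
  rw [integral_inner_rowDivergence hφ hc contDiff_id (F := fun x : E d => x), ← integral_neg]
  simp_rw [fderiv_fun_id]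
  have h2 : ∀ x, ‖-pairing (rowMap φ x) (ContinuousLinearMap.id ℝ (E d))‖ ≤ √d := fun x => by
    rw [norm_neg, pairing_rowMap, Real.norm_eq_abs]
    refine Real.abs_le_sqrt ?_
    refine (sq_sum_le_card_mul_sum_sq (s := Finset.univ)).trans ?_
    rw [Finset.card_univ, Fintype.card_fin]
    refine mul_le_of_le_one_right (Nat.cast_nonneg d) (le_trans ?_ (h1 x))
    refine Finset.sum_le_sum fun i _ => ?_
    rw [← sq_abs]
    exact pow_le_pow_left₀ (abs_nonneg _) (PiLp.norm_apply_le (φ i x) i) 2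
  rw [← setIntegral_eq_integral_of_forall_compl_eq_zero (s := Ω) fun x hx => by
    rw [rowMap_eq_zero hs hx]; simp [pairing_apply]]
  exact (le_abs_self _).trans
    (norm_setIntegral_le_of_norm_le_const hb.measure_lt_top fun x _ => h2 x)

end TotalVariation

/-! ### Total variation of the slope field -/

section SlopeVariation

variable {d : ℕ} {H : E d → ℝ} {u₀ : E d → ℝ} {M : ℝ≥0} {t : ℝ} {Ω : Set (E d)}
  {φ : Fin d → E d → E d}

/-- After integration by parts the integrand is `tr(Φᵀ DF)`, at most `γ⁻¹ div F` on `Ω`. Subtracting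
the constant `c` leaves the divergence unchanged but makes the boundary bound depend on `|F - c|`
only. -/
lemma neg_integral_inner_rowDivergence_le (hd : 0 < d) (hΩ : IsOpen Ω)
    (hA : Measure.euclideanHausdorffMeasure (d - 1) (frontier Ω) ≠ ∞)
    (hφ : ∀ i, ContDiff ℝ 1 (φ i)) (hc : ∀ i, HasCompactSupport (φ i))
    (hs : ∀ i, tsupport (φ i) ⊆ Ω) (h1 : ∀ x, ∑ i, ‖φ i x‖ ^ 2 ≤ 1)
    {F : E d → E d} (hF : ContDiff ℝ 1 F) {γ : ℝ} (hγ : 0 < γ)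
    (hFγ : ∀ B : E d →L[ℝ] E d, ‖B‖ ≤ 1 → ∀ z,
      γ * pairing B (fderiv ℝ F z) ≤ pairing (ContinuousLinearMap.id ℝ (E d)) (fderiv ℝ F z))
    {c : E d} {r s K : ℝ} (hr : 0 < r) (hrs : r < s) (hΩr : Ω ⊆ Metric.closedBall c r)
    (hK : ∀ x ∈ Metric.closedBall c s, ‖F x - c‖ ≤ K) :
    -∫ x, inner ℝ (rowDivergence φ x) (F x) ≤
      γ⁻¹ * (K * (Measure.euclideanHausdorffMeasure (d - 1)).real (frontier Ω)) := by
  have hFc : ContDiff ℝ 1 fun x => F x - c := hF.sub contDiff_const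
  have hdiv : ∀ x, divergence (fun x => F x - c) x =
      pairing (ContinuousLinearMap.id ℝ (E d)) (fderiv ℝ F x) := fun x => by
    rw [divergence_eq_pairing, fderiv_sub_const]
  have hb : Bornology.IsBounded Ω := Metric.isBounded_closedBall.subset hΩr
  have hint : IntegrableOn (divergence fun x => F x - c) Ω :=
    ((continuous_divergence hFc).continuousOn.integrableOn_compact
      (isCompact_closedBall c r)).mono_set hΩr
  rw [integral_inner_rowDivergence hφ hc hF, neg_neg,
    ← setIntegral_eq_integral_of_forall_compl_eq_zero (s := Ω) fun x hx => by
      rw [rowMap_eq_zero hs hx]; simp [pairing_apply]]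
  calc ∫ x in Ω, pairing (rowMap φ x) (fderiv ℝ F x)
      ≤ ∫ x in Ω, γ⁻¹ * divergence (fun x => F x - c) x := by
        refine integral_mono (integrable_pairing_rowMap hφ hc hF).integrableOn
          (hint.const_mul γ⁻¹) fun x => ?_
        simp only [hdiv]
        rw [← div_eq_inv_mul, le_div_iff₀' hγ]
        exact hFγ _ (norm_rowMap_le (h1 x)) x
    _ = γ⁻¹ * ∫ x in Ω, divergence (fun x => F x - c) x := integral_const_mul _ _
    _ ≤ _ := mul_le_mul_of_nonneg_left
        (setIntegral_divergence_le hd hΩ hA hFc hr hrs hΩr hK) (inv_nonneg.2 hγ.le)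

lemma neg_integral_inner_rowDivergence_foot_le (hd : 0 < d) (hH : Admissible H)
    (hu₀ : LipschitzWith M u₀) (ht : 0 < t) (h0 : H 0 = 0) (hg : gradient H 0 = 0) (hM : 0 < M)
    (hΩ : IsOpen Ω) (hb : Bornology.IsBounded Ω) (hne : Ω.Nonempty)
    (hA : Measure.euclideanHausdorffMeasure (d - 1) (frontier Ω) ≠ ∞)
    (hφ : ∀ i, ContDiff ℝ 1 (φ i)) (hc : ∀ i, HasCompactSupport (φ i))
    (hs : ∀ i, tsupport (φ i) ⊆ Ω) (h1 : ∀ x, ∑ i, ‖φ i x‖ ^ 2 ≤ 1) :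
    -∫ x, inner ℝ (rowDivergence φ x) (foot H u₀ t x) ≤
      (gammaConst H M).toReal⁻¹ * ((t * speedBound H M + Metric.diam Ω) *
        (Measure.euclideanHausdorffMeasure (d - 1)).real (frontier Ω)) := by
  obtain ⟨c, hcΩ⟩ := hne
  have hM' : (0 : ℝ) < M := hM
  have hlt := lt_momentumBound hd hH h0 hg hM'
  have hγ : 0 < (gammaConst H M).toReal :=
    ENNReal.toReal_pos (hH.dirConvexityConst_pos (hM'.trans hlt)).ne'
      (dirConvexityConst_lt_top hd (hM'.trans hlt)).ne
  have hm : AEStronglyMeasurable (foot H u₀ t) := (measurable_foot hH).aestronglyMeasurable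
  have hB := norm_foot_sub_le hH hu₀ ht h0 hg
  have hlim : Tendsto (fun n : ℕ => (gammaConst H M).toReal⁻¹ *
      ((t * speedBound H M + (Metric.diam Ω + 2 * (n + 1 : ℝ)⁻¹) + (n + 1 : ℝ)⁻¹) *
        (Measure.euclideanHausdorffMeasure (d - 1)).real (frontier Ω))) atTop
      (𝓝 ((gammaConst H M).toReal⁻¹ * ((t * speedBound H M + (Metric.diam Ω + 2 * 0) + 0) *
        (Measure.euclideanHausdorffMeasure (d - 1)).real (frontier Ω)))) := by
    have hn : Tendsto (fun n : ℕ => (n + 1 : ℝ)⁻¹) atTop (𝓝 0) := by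
      simpa only [one_div] using tendsto_one_div_add_atTop_nhds_zero_nat (𝕜 := ℝ)
    exact ((((hn.const_mul 2).const_add _).const_add _).add hn).mul_const _ |>.const_mul _
  rw [mul_zero, add_zero, add_zero] at hlim
  refine le_of_tendsto_of_tendsto (tendsto_integral_inner_mollify hm hB
    (continuous_rowDivergence hφ) (hasCompactSupport_rowDivergence hc)).neg hlim ?_
  filter_upwards [eventually_mul_pairing_fderiv_mollify_le (u₀ := u₀) hH hu₀ ht hlt] with n hn
  have hε : (0 : ℝ) < (n + 1 : ℝ)⁻¹ := by positivity
  have hD : 0 ≤ Metric.diam Ω := Metric.diam_nonneg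
  -- The radii exceed `diam Ω` by multiples of the mollification scale, which keeps them positive
  -- and distinct; the excess vanishes in the limit.
  refine neg_integral_inner_rowDivergence_le hd hΩ hA hφ hc hs h1
    (contDiff_mollify n (locallyIntegrable_of_norm_sub_le hm hB)) hγ hn (c := c)
    (r := Metric.diam Ω + (n + 1 : ℝ)⁻¹) (s := Metric.diam Ω + 2 * (n + 1 : ℝ)⁻¹)
    (by linarith) (by linarith) (fun x hx => ?_) fun x hx => ?_
  · exact (Metric.dist_le_diam_of_mem hb hx hcΩ).trans (by linarith)
  · rw [mem_closedBall_iff_norm] at hx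
    exact (norm_mollify_sub_le n hm hB).trans (by linarith)

lemma sum_integral_slope_mul_divergence_le (hd : 0 < d) (hH : Admissible H)
    (hu₀ : LipschitzWith M u₀) (ht : 0 < t) (h0 : H 0 = 0) (hg : gradient H 0 = 0) (hM : 0 < M)
    (hΩ : IsOpen Ω) (hb : Bornology.IsBounded Ω) (hne : Ω.Nonempty)
    (hA : Measure.euclideanHausdorffMeasure (d - 1) (frontier Ω) ≠ ∞)
    (hφ : ∀ i, ContDiff ℝ 1 (φ i)) (hc : ∀ i, HasCompactSupport (φ i))
    (hs : ∀ i, tsupport (φ i) ⊆ Ω) (h1 : ∀ x, ∑ i, ‖φ i x‖ ^ 2 ≤ 1) :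
    ∑ i, ∫ x in Ω, slope H u₀ t x i * divergence (φ i) x ≤
      (gammaConst H M).toReal⁻¹ * (speedBound H M + Metric.diam Ω / t) *
        (Measure.euclideanHausdorffMeasure (d - 1)).real (frontier Ω) +
      √d / t * volume.real Ω := by
  have hdc : Continuous (rowDivergence φ) := continuous_rowDivergence hφ
  have hcs := hasCompactSupport_rowDivergence hc
  have hsl : LocallyIntegrable (slope H u₀ t) := by
    obtain ⟨B, hB⟩ := exists_norm_slope_le (u₀ := u₀) hH hu₀ ht
    exact (locallyIntegrable_const B).mono (measurable_slope hH).aestronglyMeasurable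
      (Eventually.of_forall fun x => (hB x).trans (le_abs_self B))
  have hli := locallyIntegrable_foot (u₀ := u₀) hH hu₀ ht
  have e1 : ∀ i, ∫ x in Ω, slope H u₀ t x i * divergence (φ i) x =
      ∫ x, slope H u₀ t x i * divergence (φ i) x := fun i =>
    setIntegral_eq_integral_of_forall_compl_eq_zero fun x hx => by
      have h : fderiv ℝ (φ i) x = 0 := image_eq_zero_of_notMem_tsupport fun h =>
        hx (hs i (tsupport_fderiv_subset ℝ h))
      simp [divergence, h]
  have e2 : ∀ i, Integrable fun x => slope H u₀ t x i * divergence (φ i) x := fun i => by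
    have h2 : Integrable fun x => ‖divergence (φ i) x‖ • slope H u₀ t x :=
      hsl.integrable_smul_left_of_hasCompactSupport (continuous_divergence (hφ i)).norm
        (hasCompactSupport_divergence (hc i)).norm
    refine h2.mono ((((EuclideanSpace.proj (𝕜 := ℝ) i).continuous.measurable.comp
      (measurable_slope hH)).aestronglyMeasurable).mul
      (continuous_divergence (hφ i)).aestronglyMeasurable) (Eventually.of_forall fun x => ?_)
    rw [norm_smul, norm_norm, norm_mul, mul_comm]
    exact mul_le_mul_of_nonneg_left (PiLp.norm_apply_le _ _) (norm_nonneg _)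
  have hif : Integrable fun x => inner ℝ (rowDivergence φ x) (foot H u₀ t x) := by
    have h2 : Integrable fun x => ‖rowDivergence φ x‖ • foot H u₀ t x :=
      hli.integrable_smul_left_of_hasCompactSupport hdc.norm hcs.norm
    refine h2.mono (hdc.aestronglyMeasurable.inner (measurable_foot hH).aestronglyMeasurable)
      (Eventually.of_forall fun x => ?_)
    rw [norm_smul, norm_norm]
    exact norm_inner_le_norm _ _
  have hix : Integrable fun x => inner ℝ (rowDivergence φ x) x :=
    (hdc.inner continuous_id).integrable_of_hasCompactSupport
      (hcs.mono fun x hx h => hx (by simp [h]))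
  have e3 : ∀ x, ∑ i, slope H u₀ t x i * divergence (φ i) x =
      t⁻¹ * (inner ℝ (rowDivergence φ x) x - inner ℝ (rowDivergence φ x) (foot H u₀ t x)) :=
    fun x => by
      rw [← inner_rowDivergence, ← inner_sub_right, ← real_inner_smul_right,
        inv_smul_sub_foot ht]
  simp_rw [e1]
  rw [← integral_finsetSum _ fun i _ => e2 i]
  simp_rw [e3]
  rw [integral_const_mul, integral_sub hix hif]
  have b1 := integral_inner_rowDivergence_id_le hb hφ hc hs h1
  have b2 := neg_integral_inner_rowDivergence_foot_le hd hH hu₀ ht h0 hg hM hΩ hb hne hA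
    hφ hc hs h1
  calc t⁻¹ * (_ - _) ≤ t⁻¹ * (√d * volume.real Ω + (gammaConst H M).toReal⁻¹ *
        ((t * speedBound H M + Metric.diam Ω) *
          (Measure.euclideanHausdorffMeasure (d - 1)).real (frontier Ω))) :=
        mul_le_mul_of_nonneg_left (by linarith) (inv_nonneg.2 ht.le)
    _ = _ := by field_simp; ring

lemma slope_eq_zero (hH : Admissible H) (hu₀ : LipschitzWith 0 u₀) (ht : 0 < t)
    (hg : gradient H 0 = 0) (x : E d) : slope H u₀ t x = 0 := by
  have h := norm_gradient_hopfLax_le hH hu₀ ht x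
  rw [NNReal.coe_zero, norm_le_zero_iff] at h
  rw [slope, h, hg]

lemma totalVariation_slope_le (hd : 0 < d) (hH : Admissible H) (hu₀ : LipschitzWith M u₀)
    (ht : 0 < t) (h0 : H 0 = 0) (hg : gradient H 0 = 0) (hΩ : IsOpen Ω)
    (hb : Bornology.IsBounded Ω) :
    totalVariation (slope H u₀ t) Ω ≤
      (gammaConst H M)⁻¹ * ENNReal.ofReal (speedBound H M + Metric.diam Ω / t) *
        Measure.euclideanHausdorffMeasure (d - 1) (frontier Ω) +
      ENNReal.ofReal (√d / t) * volume Ω := by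
  refine iSup_le fun φ => iSup_le fun hφ => iSup_le fun h1 => ?_
  rcases eq_or_ne M 0 with rfl | hM
  -- For `M = 0` the solution is constant in `x`, so `b = 0`; the strict inequality `M < R_M` is
  -- established only for positive `M`.
  · simp [slope_eq_zero hH hu₀ ht hg]
  rcases Ω.eq_empty_or_nonempty with rfl | hne
  · simp
  have hM' : (0 : ℝ) < M := by exact_mod_cast pos_iff_ne_zero.2 hM
  have hR := hM'.trans (lt_momentumBound hd hH h0 hg hM')
  have hγ0 : 0 < gammaConst H M := hH.dirConvexityConst_pos hR
  have hγt : gammaConst H M < ∞ := dirConvexityConst_lt_top hd hR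
  have hΛ : 0 < speedBound H M + Metric.diam Ω / t :=
    add_pos_of_pos_of_nonneg (speedBound_pos hd hH h0 hg hM')
      (div_nonneg Metric.diam_nonneg ht.le)
  by_cases hA : Measure.euclideanHausdorffMeasure (d - 1) (frontier Ω) = ∞
  -- The coefficient of the infinite boundary measure is nonzero, because `γ_M < ∞` and `Λ_M > 0`,
  -- so the right-hand side is `∞`.
  · rw [hA, ENNReal.mul_top, top_add]
    · exact le_top
    · exact mul_ne_zero (ENNReal.inv_ne_zero.2 hγt.ne) (ENNReal.ofReal_pos.2 hΛ).ne'
  refine (ENNReal.ofReal_le_ofReal (sum_integral_slope_mul_divergence_le hd hH hu₀ ht h0 hg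
    (pos_iff_ne_zero.2 hM) hΩ hb hne hA (fun i => (hφ i).1) (fun i => (hφ i).2.1)
    (fun i => (hφ i).2.2) h1)).trans ?_
  have hγ : (0 : ℝ) ≤ (gammaConst H M).toReal⁻¹ := inv_nonneg.2 ENNReal.toReal_nonneg
  refine ENNReal.ofReal_add_le.trans (le_of_eq ?_)
  rw [ENNReal.ofReal_mul (mul_nonneg hγ hΛ.le), ENNReal.ofReal_mul hγ,
    ENNReal.ofReal_mul (by positivity), Measure.real, Measure.real, ENNReal.ofReal_toReal hA,
    ENNReal.ofReal_toReal hb.measure_lt_top.ne, ENNReal.ofReal_inv_of_pos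
      (ENNReal.toReal_pos hγ0.ne' hγt.ne), ENNReal.ofReal_toReal hγt.ne]

end SlopeVariation

end HamiltonJacobi

end

theorem mainTheorem1 (d : ℕ) (hd : 0 < d) (H : HamiltonJacobi.E d → ℝ)
    (hC1 : ContDiff ℝ 1 H) (hconv : StrictConvexOn ℝ Set.univ H)
    (hcoer : HamiltonJacobi.Coercive H)
    (hudc : HamiltonJacobi.UniformlyDirectionallyConvex H)
    (u₀ : HamiltonJacobi.E d → ℝ) (M : ℝ≥0) (hu₀ : LipschitzWith M u₀)
    (t : ℝ) (ht : 0 < t) :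
    (∀ᵐ x : HamiltonJacobi.E d,
        DifferentiableAt ℝ (HamiltonJacobi.hopfLax H u₀ t) x ∧
        HamiltonJacobi.backwardSlopes H u₀ t x = {HamiltonJacobi.slope H u₀ t x}) ∧
      HamiltonJacobi.IsLocallyBV (HamiltonJacobi.slope H u₀ t) ∧
      (H 0 = 0 → gradient H 0 = 0 →
        ∀ Ω : Set (HamiltonJacobi.E d), IsOpen Ω → Bornology.IsBounded Ω →
          HamiltonJacobi.perimeter Ω < ∞ →
            HamiltonJacobi.totalVariation (HamiltonJacobi.slope H u₀ t) Ω ≤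
              (HamiltonJacobi.gammaConst H M)⁻¹ *
                  ENNReal.ofReal (HamiltonJacobi.speedBound H M + Metric.diam Ω / t) *
                  MeasureTheory.Measure.euclideanHausdorffMeasure (d - 1) (frontier Ω) +
                ENNReal.ofReal (√(d : ℝ) / t) * volume Ω) := by
  have hH : HamiltonJacobi.Admissible H := ⟨hC1, hcoer, hudc⟩
  refine ⟨?_, HamiltonJacobi.isLocallyBV_slope hd hH hu₀ ht, fun h0 hg Ω hΩ hb _ =>
    HamiltonJacobi.totalVariation_slope_le hd hH hu₀ ht h0 hg hΩ hb⟩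
  filter_upwards [HamiltonJacobi.ae_differentiableAt_hopfLax hH hu₀ ht] with x hx
  exact ⟨hx, HamiltonJacobi.backwardSlopes_eq hH hu₀ ht hx⟩
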